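/- All graphs are finite and simple with at least one vertex. For every graph $G$ let $X(G)$ be a set of subsets of $V(G)$, and let $p(G;\cdot)$ be a function that maps each member of $X(G)$ to a nonnegative integer. Let $x(G)=\min_{S\in X(G)}|S|$ (a minimum over the empty set is $+\infty$). Consider the decision problems - Minimum $X$ Set: given a graph $G$ and an integer $k$, is $x(G)<k$? - $(X,p)$-Throttling: given a graph $G$ and an integer $k$, is $\min_{S\in X(G)}\{|S|+p(G;S)\}<k$? Graphs are given by adjacency matrices and integers in binary. Let $G_1\,\dot\cup\,G_2$ denote the disjoint union of two graphs (and likewise for vertex sets). Suppose that membership $S\in X(G)$ is polynomially verifiable, i.e. the problem "given a graph $G$ and $S\subseteq V(G)$, is $S\in X(G)$?" is in NP, and that the following hold. 1. There are constants $c, C$ and, for every graph $G$, a nonnegative integer $b=b(G)\le C\,|V(G)|^{c}$ with $p(G;S)<b(G)$ for every $S\in X(G)$; moreover $b(G)$ can be computed from $G$, and $p(G;S)$ can be computed from $G$ and $S\in X(G)$, in time polynomial in $|V(G)|$. 2. For all graphs $G_1,G_2$: $X(G_1\,\dot\cup\,G_2)=\{S_1\,\dot\cup\,S_2 : S_1\in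 X(G_1),\ S_2\in X(G_2)\}$. 3. For all graphs $G_1,G_2$ and all $S_1\in X(G_1)$, $S_2\in X(G_2)$: $p(G_1\,\dot\cup\,G_2;\,S_1\,\dot\cup\,S_2)=\max\{p(G_1;S_1),\,p(G_2;S_2)\}$. 4. Minimum $X$ Set is NP-complete (under polynomial-time many-one reductions). Then $(X,p)$-Throttling is NP-complete. -/

import Mathlib

namespace Throttling

/-! ### Graphs, vertex-set families and the two parameters -/

/-- A finite simple graph of nonzero order, on the vertex set `{0, …, order - 1}`. -/
structure FinGraph where
  /-- the number of vertices -/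
  order : ℕ
  /-- graphs have at least one vertex -/
  order_pos : 0 < order
  /-- the adjacency structure -/
  graph : SimpleGraph (Fin order)

/-- The vertices of a graph. -/
abbrev FinGraph.V (G : FinGraph) : Type := Fin G.order

/-- The disjoint union of two graphs: the vertices of `G` come first, those of `H` after them. -/
def FinGraph.disjUnion (G H : FinGraph) : FinGraph where
  order := G.order + H.order
  order_pos := Nat.add_pos_left G.order_pos _
  graph := (G.graph ⊕g H.graph).map finSumFinEquiv.toEmbedding

/-- The disjoint union of a vertex set of `G` and a vertex set of `H`, as a vertex set of the
disjoint union of `G` and `H`. -/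
def setUnion {G H : FinGraph} (S : Finset G.V) (T : Finset H.V) : Finset (G.disjUnion H).V :=
  (S.disjSum T).map finSumFinEquiv.toEmbedding

/-- The parameter `x(G) = min_{S ∈ X(G)} |S|`, which is `⊤` if `X(G)` is empty. -/
noncomputable def setNumber (X : (G : FinGraph) → Set (Finset G.V)) (G : FinGraph) : ℕ∞ :=
  ⨅ S ∈ X G, (S.card : ℕ∞)

/-- The throttling number `min_{S ∈ X(G)} (|S| + p(G; S))`, which is `⊤` if `X(G)` is empty. -/
noncomputable def throttlingNumber (X : (G : FinGraph) → Set (Finset G.V))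
    (p : (G : FinGraph) → Finset G.V → ℕ) (G : FinGraph) : ℕ∞ :=
  ⨅ S ∈ X G, ((S.card + p G S : ℕ) : ℕ∞)

/-- Minimum `X` Set: the pairs `(G, k)`, `k` an integer, with `x(G) < k`. -/
def MinimumXSet (X : (G : FinGraph) → Set (Finset G.V)) : Set (FinGraph × ℤ) :=
  {I | ∃ m : ℕ, setNumber X I.1 = m ∧ (m : ℤ) < I.2}

/-- `(X, p)`-Throttling: the pairs `(G, k)`, `k` an integer, with
`min_{S ∈ X(G)} (|S| + p(G; S)) < k`. -/
def XPThrottling (X : (G : FinGraph) → Set (Finset G.V))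
    (p : (G : FinGraph) → Finset G.V → ℕ) : Set (FinGraph × ℤ) :=
  {I | ∃ m : ℕ, throttlingNumber X p I.1 = m ∧ (m : ℤ) < I.2}

/-! ### Encodings by strings

The alphabet is `Option Bool`: the bits, and a separator `none`. -/

open Classical in
/-- The adjacency matrix, row by row, each row followed by a separator. -/
noncomputable def encodeGraph (G : FinGraph) : List (Option Bool) :=
  (List.finRange G.order).flatMap fun i =>
    ((List.finRange G.order).map fun j => some (decide (G.graph.Adj i j))) ++ [none]

/-- The indicator vector of a set of vertices. -/
def encodeSet {n : ℕ} (S : Finset (Fin n)) : List (Option Bool) :=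
  (List.finRange n).map fun i => some (decide (i ∈ S))

/-- A graph and a set of its vertices: the graph, then the indicator vector of the set. -/
noncomputable def encodeGraphSet (I : (G : FinGraph) × Finset G.V) : List (Option Bool) :=
  encodeGraph I.1 ++ encodeSet I.2

/-- A sign bit followed by the binary digits of the absolute value. -/
def encodeInt (k : ℤ) : List Bool :=
  decide (k < 0) :: Computability.encodeNat k.natAbs

/-- A graph and an integer: the graph, then the integer in binary. -/
noncomputable def encodeGraphInt (I : FinGraph × ℤ) : List (Option Bool) :=
  encodeGraph I.1 ++ (encodeInt I.2).map some

/-- An instance together with a binary witness; the two are written in disjoint alphabets. -/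
def encodeWithWitness {α Γ : Type} (enc : α → List Γ) (I : α × List Bool) : List (Γ ⊕ Bool) :=
  (enc I.1).map Sum.inl ++ I.2.map Sum.inr

/-! ### Polynomial time and NP-completeness -/

/-- `f` is computed by a (multi-stack) Turing machine whose running time is bounded by a polynomial
in the length of the encoded input. The machine only has to work on encodings of elements of `α`. -/
def PolyTime {α β Γ Δ : Type} (ea : α → List Γ) (eb : β → List Δ) (f : α → β) : Prop :=
  Nonempty (Turing.TM2ComputableInPolyTime ea eb f)

/-- The decision problem `L`, on instances encoded by `enc`, is in NP: membership is witnessed by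
binary strings of polynomial length that a polynomial-time verifier checks. -/
def InNP {α Γ : Type} (enc : α → List Γ) (L : Set α) : Prop :=
  ∃ (verifier : α × List Bool → Bool) (q : Polynomial ℕ),
    PolyTime (encodeWithWitness enc) Computability.encodeBool verifier ∧
    ∀ x, x ∈ L ↔ ∃ w : List Bool, w.length ≤ q.eval (enc x).length ∧ verifier (x, w) = true

/-- Every language over the binary alphabet that is in NP has a polynomial-time many-one reduction
to `L`. -/
def NPHard {α Γ : Type} (enc : α → List Γ) (L : Set α) : Prop :=
  ∀ A : Set (List Bool), InNP id A →
    ∃ f : List Bool → α, PolyTime id enc f ∧ ∀ w, w ∈ A ↔ f w ∈ L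

/-- `L` is NP-complete. -/
def NPComplete {α Γ : Type} (enc : α → List Γ) (L : Set α) : Prop :=
  InNP enc L ∧ NPHard enc L

end Throttling

/-!
The problem is in NP: a witness for `(G, k)` consists of a set `S` and a witness for `S ∈ X G`, and
a verifier checks the latter, computes `p G S`, and compares `|S| + p G S` with `k`
(`Throttling.inNP_XPThrottling`). As `p` can be computed only on members of `X G`, the verifier must
not run the machine for `p` before it has made sure that `S ∈ X G`; in particular it has to truncate
the second witness to the length for which acceptance implies membership.

The problem is NP-hard: Minimum `X` Set is reduced to it by taking many disjoint copies of the
graph. Replacing `(G, k)` by `(G ⊔ G, 2 * k)` repeatedly, `i` times, gives `2 ^ i` copies of `G`.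
Members of `X` for the copies are families of `2 ^ i` members of `X G`, and `p` takes the maximum
over the family. If `2 ^ i ≥ C * |V(G)| ^ c`, then this maximum is less than `2 ^ i`, so that the
throttling number of the copies is less than `2 ^ i * k` if and only if `x(G) < k`
(`Throttling.reduction_mem_XPThrottling`). If `i` is about `c * log₂ |V(G)| + C`, then the size of
the copies is also polynomial in that of `G` (`Throttling.polyTime_reduction`).

What takes most of the space is that all of this is done by Turing machines in polynomial time.
Mathlib has the multi-stack machines `Turing.FinTM2` and `Turing.TM2ComputableInPolyTime`, but no
way of combining machines. Here a *controller* is a finite program with stacks of its own which runs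
given machines as subroutines; it is again such a machine (`Throttling.Controller.runs_call`).
Particular controllers show that the relation `Throttling.FP` (strings `O a` can be computed from
strings `I a`, uniformly in a parameter `a` on which nothing else is assumed) is closed under
composition (`Throttling.FP.trans`), pairing (`Throttling.FP.pair`), polynomially bounded iteration
(`Throttling.FP.loop`) and the application of finite-state transducers (`Throttling.FP.run`).
Everything else, such as adding and comparing binary numbers, splitting strings, conditionals
(`Throttling.FP.guard`) and doubling an adjacency matrix, is obtained from these, by loops whose
bodies are mostly transducers.
-/

namespace Throttling

open Turing Function

/-! ### Runs of bounded length -/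

/-- Iterating the partial step function `f` leads from `a` to `b` in at most `n` steps. -/
def ReachesIn {σ : Type} (f : σ → Option σ) (n : ℕ) (a b : σ) : Prop :=
  ∃ m ≤ n, (flip bind f)^[m] (some a) = some b

namespace ReachesIn

variable {σ : Type} {f : σ → Option σ} {a b c : σ} {m n : ℕ}

theorem single (h : f a = some b) : ReachesIn f 1 a b := ⟨1, le_rfl, h⟩

theorem mono (h : ReachesIn f m a b) (hmn : m ≤ n) : ReachesIn f n a b :=
  let ⟨k, hk, e⟩ := h
  ⟨k, hk.trans hmn, e⟩

theorem trans (h₁ : ReachesIn f m a b) (h₂ : ReachesIn f n b c) : ReachesIn f (m + n) a c := by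
  obtain ⟨k, hk, e⟩ := h₁
  obtain ⟨l, hl, e'⟩ := h₂
  exact ⟨l + k, by omega, by rw [iterate_add_apply, e, e']⟩

theorem head (h₁ : f a = some b) (h₂ : ReachesIn f n b c) : ReachesIn f (n + 1) a c :=
  ((single h₁).trans h₂).mono (by omega)

/-- A quantity that grows by at most `C` in every step grows by at most `C * n` in `n` steps. -/
theorem le_add_mul {μ : σ → ℕ} {C : ℕ} (hμ : ∀ x y, f x = some y → μ y ≤ μ x + C)
    (h : ReachesIn f n a b) : μ b ≤ μ a + C * n := by
  obtain ⟨k, hk, e⟩ := h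
  have : ∀ k b, (flip bind f)^[k] (some a) = some b → μ b ≤ μ a + C * k := by
    intro k
    induction k with
    | zero => intro b hb; cases hb; simp
    | succ k ih =>
      intro b hb
      rw [iterate_succ_apply'] at hb
      cases hc : (flip bind f)^[k] (some a) with
      | none => rw [hc] at hb; cases hb
      | some c =>
        rw [hc] at hb
        have := hμ c b hb
        have := ih c hc
        rw [Nat.mul_succ]; omega
  exact (this k b e).trans (by gcongr)

end ReachesIn

/-- A simulation that maps every single step to a single step maps runs to runs. -/
theorem ReachesIn.map {σ τ : Type} {f : σ → Option σ} {g : τ → Option τ} {φ : σ → τ}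
    (hφ : ∀ x y, f x = some y → g (φ x) = some (φ y)) {n : ℕ} {a b : σ}
    (h : ReachesIn f n a b) : ReachesIn g n (φ a) (φ b) := by
  obtain ⟨k, hk, e⟩ := h
  refine ⟨k, hk, ?_⟩
  clear hk
  induction k generalizing b with
  | zero => cases e; rfl
  | succ k ih =>
    rw [iterate_succ_apply'] at e ⊢
    cases hc : (flip bind f)^[k] (some a) with
    | none => rw [hc] at e; cases e
    | some c => rw [hc] at e; rw [ih hc]; exact hφ c b e

/-! ### Stack contents -/

/-- The stack contents in which only the stack `k` may be nonempty. -/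
def only {K : Type} [DecidableEq K] {Γ : K → Type} (k : K) (l : List (Γ k)) : ∀ k, List (Γ k) :=
  update (fun _ => []) k l

section only

variable {K : Type} [DecidableEq K] {Γ : K → Type} (k : K) (l : List (Γ k))

@[simp] theorem only_self : only k l k = l := by simp [only]

@[simp] theorem update_only (l' : List (Γ k)) : update (only k l) k l' = only k l' := by
  simp [only]

@[simp] theorem only_nil : only k ([] : List (Γ k)) = fun _ => [] := by simp [only]

theorem update_nil_eq_only : update (fun _ => []) k l = only k l := rfl

end only

/-- Push a list of symbols, each on its own stack, one after the other. -/
def pushAll {K : Type} [DecidableEq K] {Γ : K → Type} :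
    List (Σ k, Γ k) → (∀ k, List (Γ k)) → ∀ k, List (Γ k)
  | [], S => S
  | x :: w, S => pushAll w (update S x.1 (x.2 :: S x.1))

section pushAll

variable {K : Type} [DecidableEq K] {Γ : K → Type}

@[simp] theorem pushAll_nil (S : ∀ k, List (Γ k)) : pushAll [] S = S := rfl

@[simp] theorem pushAll_cons (x : Σ k, Γ k) (w) (S : ∀ k, List (Γ k)) :
    pushAll (x :: w) S = pushAll w (update S x.1 (x.2 :: S x.1)) := rfl

theorem pushAll_append (w w' : List (Σ k, Γ k)) (S : ∀ k, List (Γ k)) :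
    pushAll (w ++ w') S = pushAll w' (pushAll w S) := by
  induction w generalizing S with
  | nil => rfl
  | cons x w ih => simp [ih]

theorem pushAll_map {β : Type} (k : K) (g : β → Γ k) (l : List β) (S : ∀ k, List (Γ k)) :
    pushAll (l.map fun x => ⟨k, g x⟩) S = update S k ((l.map g).reverse ++ S k) := by
  induction l generalizing S with
  | nil => simp
  | cons x l ih => simp [ih]

/-- Simultaneous pushes of the images of the same list on two different stacks. -/
theorem pushAll_flatMap_pair {β : Type} {k k' : K} (hk : k ≠ k') (g : β → Γ k) (g' : β → Γ k')
    (l : List β) (S : ∀ k, List (Γ k)) :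
    pushAll (l.flatMap fun x => [⟨k, g x⟩, ⟨k', g' x⟩]) S =
      update (update S k ((l.map g).reverse ++ S k)) k' ((l.map g').reverse ++ S k') := by
  induction l generalizing S with
  | nil => simp
  | cons x l ih =>
    simp only [List.flatMap_cons, List.cons_append, List.nil_append, pushAll_cons, ih]
    funext i
    rcases eq_or_ne i k' with rfl | h
    · simp [hk.symm]
    · rcases eq_or_ne i k with rfl | h'
      · simp [hk]
      · simp [h, h']

theorem pushAll_update_of_forall_ne (w : List (Σ k, Γ k)) {k : K} (hw : ∀ x ∈ w, x.1 ≠ k)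
    (S : ∀ k, List (Γ k)) (l : List (Γ k)) :
    pushAll w (update S k l) = update (pushAll w S) k l := by
  induction w generalizing S with
  | nil => rfl
  | cons x w ih =>
    rw [pushAll_cons, pushAll_cons, update_of_ne (hw x (by simp)),
      update_comm (hw x (by simp)).symm, ih fun y hy => hw y (by simp [hy])]

theorem pushAll_apply_of_forall_ne (w : List (Σ k, Γ k)) {k : K} (hw : ∀ x ∈ w, x.1 ≠ k)
    (S : ∀ k, List (Γ k)) : pushAll w S k = S k := by
  induction w generalizing S with
  | nil => rfl
  | cons x w ih =>
    rw [pushAll_cons, ih (fun y hy => hw y (by simp [hy])), update_of_ne (hw x (by simp)).symm]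

end pushAll

/-! ### Controllers: finite programs that call other machines -/

section Controller

variable {J : Type} (M : J → FinTM2) {E : Type} (A : E → Type)

/-- The stacks of a controller: its own ones, and those of the machines that it calls. -/
abbrev Stack (M : J → FinTM2) (E : Type) : Type := E ⊕ Σ j, (M j).K

/-- The alphabets of the contents of a controller. -/
abbrev Alphabet : Stack M E → Type
  | Sum.inl x => A x
  | Sum.inr x => (M x.1).Γ x.2

/-- The labels of a controller with own labels `Q`: the labels of a machine that it calls carry the
own label to which that machine returns when it halts. -/
abbrev Label (Q : Type) : Type := Q ⊕ Σ j, (M j).Λ × Q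

/-- A controller runs over stacks of its own and the stacks of the machines `M j`. At each own label
it pops a symbol from one stack and, depending on the outcome, pushes finitely many symbols and
passes to an own label, starts one of the machines `M j`, or halts (`none`). -/
structure Controller {J : Type} (M : J → FinTM2) {E : Type} (A : E → Type) where
  /-- the own labels -/
  Q : Type
  /-- there are finitely many own labels -/
  [finQ : Fintype Q]
  /-- the stack that is popped at an own label -/
  src : Q → Stack M E
  /-- the symbols that an own label can find on its stack -/
  fin_src : ∀ q, Finite (Alphabet M A (src q))
  /-- the symbols to push and the next label, depending on the popped symbol -/
  code : (q : Q) → Option (Alphabet M A (src q)) →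
    List (Σ k, Alphabet M A k) × Option (Label M Q)
  /-- the label at which the controller starts -/
  start : Label M Q

attribute [instance] Controller.finQ

/-- The label at which the machine `M j` starts, to return to the own label `q`. -/
def call {M : J → FinTM2} {Q : Type} (j : J) (q : Q) : Label M Q := Sum.inr ⟨j, (M j).main, q⟩

variable {M A}

/-- Stack contents of a controller, assembled from those of its own stacks and those of the machines
that it calls. -/
def contents (e : ∀ x, List (A x)) (m : ∀ j k, List ((M j).Γ k)) : ∀ k, List (Alphabet M A k)
  | Sum.inl x => e x
  | Sum.inr x => m x.1 x.2

@[simp] theorem contents_inl (e : ∀ x, List (A x)) (m : ∀ j k, List ((M j).Γ k)) (x : E) :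
    contents e m (Sum.inl x) = e x := rfl

@[simp] theorem contents_inr (e : ∀ x, List (A x)) (m : ∀ j k, List ((M j).Γ k))
    (x : Σ j, (M j).K) : contents e m (Sum.inr x) = m x.1 x.2 := rfl

section update

variable [DecidableEq J] [DecidableEq E] (e : ∀ x, List (A x)) (m : ∀ j k, List ((M j).Γ k))

@[simp] theorem update_contents_inl (x : E) (l : List (A x)) :
    update (contents e m) (Sum.inl x) l = contents (update e x l) m := by
  funext k
  rcases k with y | y
  · rcases eq_or_ne y x with rfl | h
    · simp
    · simp [h]
  · simp

@[simp] theorem update_contents_inr (j : J) (k : (M j).K) (l : List ((M j).Γ k)) :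
    update (contents e m) (Sum.inr ⟨j, k⟩) l = contents e (update m j (update (m j) k l)) := by
  funext i
  rcases i with y | ⟨j', k'⟩
  · simp
  · rcases eq_or_ne j' j with rfl | h
    · rcases eq_or_ne k' k with rfl | h'
      · simp
      · rw [update_of_ne (by simpa using h')]
        simp [h']
    · rw [update_of_ne (by rintro ⟨⟩; exact h rfl)]
      simp [h]

end update

namespace Controller

variable (C : Controller M A)

/-- The internal memory of the machine of a controller: the symbol that was popped last, and the
internal memories of the machines that it calls. -/
abbrev Memory : Type := Option (Σ q, Option (Alphabet M A (C.src q))) × ∀ j, (M j).σ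

instance : Finite (Σ q, Option (Alphabet M A (C.src q))) :=
  have := C.fin_src
  inferInstance

/-- The statements of the machine of a controller. -/
abbrev Stmt : Type := TM2.Stmt (Alphabet M A) (Label M C.Q) C.Memory

/-- A statement that pushes given symbols and continues with `r`. -/
def pushStmt (w : List (Σ k, Alphabet M A k)) (r : C.Stmt) : C.Stmt :=
  w.foldr (fun x r => .push x.1 (fun _ => x.2) r) r

/-- The statement that passes to the label `l`, or halts. -/
def gotoStmt : Option (Label M C.Q) → C.Stmt
  | none => .halt
  | some l => .goto fun _ => l

open Classical in
/-- A statement that branches according to the symbol in the memory. -/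
noncomputable def caseStmt (act : (Σ q, Option (Alphabet M A (C.src q))) → C.Stmt) : C.Stmt :=
  (@Finset.univ _ (Fintype.ofFinite (Σ q, Option (Alphabet M A (C.src q))))).toList.foldr
    (fun t r => .branch (fun v => decide (v.1 = some t)) (act t) r) .halt

/-- The statement executed at an own label. -/
noncomputable def ownStmt (q : C.Q) : C.Stmt :=
  .pop (C.src q) (fun v x => (some ⟨q, x⟩, v.2)) <| C.caseStmt fun t =>
    C.pushStmt (C.code t.1 t.2).1 <| .load (fun v => (none, v.2)) <|
      C.gotoStmt (C.code t.1 t.2).2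

variable [DecidableEq J]

/-- A statement of the machine `M j`, with a return to the own label `q` in place of halting. -/
def callStmt (j : J) (q : C.Q) : TM2.Stmt (M j).Γ (M j).Λ (M j).σ → C.Stmt
  | .push k f s => .push (Sum.inr ⟨j, k⟩) (fun v => f (v.2 j)) (callStmt j q s)
  | .peek k f s => .peek (Sum.inr ⟨j, k⟩) (fun v x => (v.1, update v.2 j (f (v.2 j) x)))
      (callStmt j q s)
  | .pop k f s => .pop (Sum.inr ⟨j, k⟩) (fun v x => (v.1, update v.2 j (f (v.2 j) x)))
      (callStmt j q s)
  | .load f s => .load (fun v => (v.1, update v.2 j (f (v.2 j)))) (callStmt j q s)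
  | .branch f s s' => .branch (fun v => f (v.2 j)) (callStmt j q s) (callStmt j q s')
  | .goto f => .goto fun v => Sum.inr ⟨j, f (v.2 j), q⟩
  | .halt => .goto fun _ => Sum.inl q

/-- The statements of the machine of a controller. -/
noncomputable def prog : Label M C.Q → C.Stmt
  | Sum.inl q => C.ownStmt q
  | Sum.inr x => C.callStmt x.1 x.2.2 ((M x.1).m x.2.1)

/-- The configuration with given label and stack contents and with the internal memory reset. -/
def cfg (l : Option (Label M C.Q)) (S : ∀ k, List (Alphabet M A k)) :
    TM2.Cfg (Alphabet M A) (Label M C.Q) C.Memory :=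
  ⟨l, (none, fun j => (M j).initialState), S⟩

variable [DecidableEq E]

theorem stepAux_pushStmt (w : List (Σ k, Alphabet M A k)) (r : C.Stmt) (v : C.Memory)
    (S : ∀ k, List (Alphabet M A k)) :
    TM2.stepAux (C.pushStmt w r) v S = TM2.stepAux r v (pushAll w S) := by
  induction w generalizing S with
  | nil => rfl
  | cons x w ih => exact ih _

theorem stepAux_caseStmt (act : (Σ q, Option (Alphabet M A (C.src q))) → C.Stmt)
    (v : C.Memory) (S : ∀ k, List (Alphabet M A k)) {t} (ht : v.1 = some t) :
    TM2.stepAux (C.caseStmt act) v S = TM2.stepAux (act t) v S := by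
  classical
  let inst := Fintype.ofFinite (Σ q, Option (Alphabet M A (C.src q)))
  have hmem : t ∈ (@Finset.univ _ inst).toList := by simp
  unfold caseStmt
  generalize (@Finset.univ _ inst).toList = L at hmem ⊢
  induction L with
  | nil => cases hmem
  | cons u L ih =>
    simp only [List.foldr_cons, TM2.stepAux]
    by_cases hu : t = u
    · subst hu; simp [ht]
    · have : decide (v.1 = some u) = false := by simp [ht, hu]
      rw [this]
      exact ih (by simpa [hu] using hmem)

theorem step_own (q : C.Q) (S : ∀ k, List (Alphabet M A k)) :
    TM2.step C.prog (C.cfg (some (Sum.inl q)) S) =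
      some (C.cfg (C.code q (S (C.src q)).head?).2
        (pushAll (C.code q (S (C.src q)).head?).1 (update S (C.src q) (S (C.src q)).tail))) := by
  simp only [cfg, TM2.step, prog, ownStmt, TM2.stepAux]
  rw [C.stepAux_caseStmt _ _ _ rfl, stepAux_pushStmt]
  simp only [TM2.stepAux]
  cases (C.code q (S (C.src q)).head?).2 <;> simp [gotoStmt, TM2.stepAux]

/-- A configuration of the machine `M j`, seen as a configuration of the controller. -/
def embed (j : J) (q : C.Q) (e : ∀ x, List (A x)) (m : ∀ j k, List ((M j).Γ k))
    (c : TM2.Cfg (M j).Γ (M j).Λ (M j).σ) : TM2.Cfg (Alphabet M A) (Label M C.Q) C.Memory :=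
  ⟨some (c.l.elim (Sum.inl q) fun l => Sum.inr ⟨j, l, q⟩),
    (none, update (fun j => (M j).initialState) j c.var), contents e (update m j c.stk)⟩

theorem stepAux_callStmt (j : J) (q : C.Q) (e : ∀ x, List (A x)) (m : ∀ j k, List ((M j).Γ k))
    (s : TM2.Stmt (M j).Γ (M j).Λ (M j).σ) (v : (M j).σ) (R : ∀ k, List ((M j).Γ k)) :
    TM2.stepAux (C.callStmt j q s) (none, update (fun j => (M j).initialState) j v)
      (contents e (update m j R)) = C.embed j q e m (TM2.stepAux s v R) := by
  induction s generalizing v R with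
  | push k f s ih => simp [callStmt, TM2.stepAux, ← ih]
  | peek k f s ih => simp [callStmt, TM2.stepAux, ← ih]
  | pop k f s ih => simp [callStmt, TM2.stepAux, ← ih]
  | load f s ih => simp [callStmt, TM2.stepAux, ← ih]
  | branch f s s' ih ih' =>
    simp only [callStmt, TM2.stepAux, update_self]
    cases f v
    · exact ih' v R
    · exact ih v R
  | goto f => simp [callStmt, TM2.stepAux, embed]
  | halt => simp [callStmt, TM2.stepAux, embed]

theorem initList_eq (tm : FinTM2) (l : List (tm.Γ tm.k₀)) :
    initList tm l = (⟨some tm.main, tm.initialState, only tm.k₀ l⟩ : tm.Cfg) := by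
  simp only [initList]
  congr 1
  funext k
  by_cases h : k = tm.k₀
  · subst h; simp
  · simp [h, only]

theorem haltList_eq (tm : FinTM2) (l : List (tm.Γ tm.k₁)) :
    haltList tm l = (⟨none, tm.initialState, only tm.k₁ l⟩ : tm.Cfg) := by
  simp only [haltList]
  congr 1
  funext k
  by_cases h : k = tm.k₁
  · subst h; simp
  · simp [h, only]

/-- The controller gets from the label `l` with stack contents `S` to the label `l'` with stack
contents `S'` in at most `n` steps. -/
def Runs (n : ℕ) (l : Option (Label M C.Q)) (S : ∀ k, List (Alphabet M A k))
    (l' : Option (Label M C.Q)) (S' : ∀ k, List (Alphabet M A k)) : Prop :=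
  ReachesIn (TM2.step C.prog) n (C.cfg l S) (C.cfg l' S')

variable {C} in
theorem Runs.trans {n n' : ℕ} {l l' l'' : Option (Label M C.Q)}
    {S S' S'' : ∀ k, List (Alphabet M A k)} (h : C.Runs n l S l' S')
    (h' : C.Runs n' l' S' l'' S'') : C.Runs (n + n') l S l'' S'' :=
  ReachesIn.trans h h'

variable {C} in
theorem Runs.mono {n n' : ℕ} {l l' : Option (Label M C.Q)}
    {S S' : ∀ k, List (Alphabet M A k)} (h : C.Runs n l S l' S') (hn : n ≤ n') :
    C.Runs n' l S l' S' :=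
  ReachesIn.mono h hn

variable {C} in
theorem Runs.congr {n : ℕ} {l l' : Option (Label M C.Q)} {S T S' T' : ∀ k, List (Alphabet M A k)}
    (h : C.Runs n l S l' S') (hS : T = S) (hS' : T' = S') : C.Runs n l T l' T' := by
  rw [hS, hS']
  exact h

/-- A controller can run the machine `M j` as a subroutine. -/
theorem runs_call (j : J) (q : C.Q) (e : ∀ x, List (A x)) (m : ∀ j k, List ((M j).Γ k))
    {l : List ((M j).Γ (M j).k₀)} {l' : List ((M j).Γ (M j).k₁)} {t : ℕ}
    (h : ReachesIn (M j).step t (initList (M j) l) (haltList (M j) l')) :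
    C.Runs t (some (call j q)) (contents e (update m j (only (M j).k₀ l)))
      (some (Sum.inl q)) (contents e (update m j (only (M j).k₁ l'))) := by
  have key := h.map (g := TM2.step C.prog) (φ := C.embed j q e m) ?_
  · rw [initList_eq, haltList_eq] at key
    simpa [embed, Runs, cfg, call] using key
  · rintro ⟨_ | l, v, R⟩ y hy
    · cases hy
    · simp only [FinTM2.step, TM2.step, Option.some.injEq] at hy
      simp only [embed, TM2.step, Option.elim_some, prog, stepAux_callStmt]
      exact congrArg (fun y => some (C.embed j q e m y)) hy

theorem runs_own {q : C.Q} {S : ∀ k, List (Alphabet M A k)} {l : List (Alphabet M A (C.src q))}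
    (hS : S (C.src q) = l) {w : List (Σ k, Alphabet M A k)} {l' : Option (Label M C.Q)}
    (hc : C.code q l.head? = (w, l')) :
    C.Runs 1 (some (Sum.inl q)) S l' (pushAll w (update S (C.src q) l.tail)) := by
  refine ReachesIn.single ?_
  rw [step_own, hS, hc]

/-- A label that pops one stack until it is empty, pushing symbols for each symbol that it finds. -/
theorem runs_move {q : C.Q} {e : List (Alphabet M A (C.src q))} {l' : Option (Label M C.Q)}
    {w : Alphabet M A (C.src q) → List (Σ k, Alphabet M A k)}
    {w' : List (Σ k, Alphabet M A k)}
    (hsome : ∀ x, C.code q (some x) = (w x, some (Sum.inl q)))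
    (hnone : C.code q none = (w', l'))
    (hw : ∀ x, ∀ y ∈ w x, y.1 ≠ C.src q)
    {S : ∀ k, List (Alphabet M A k)} (hS : S (C.src q) = e) :
    C.Runs (e.length + 1) (some (Sum.inl q)) S l'
      (pushAll w' (pushAll (e.flatMap w) (update S (C.src q) []))) := by
  induction e generalizing S with
  | nil =>
    refine ReachesIn.single ?_
    rw [step_own, hS]
    simp [hnone]
  | cons x e ih =>
    refine ReachesIn.head (C.step_own q S) ?_
    rw [hS, List.head?_cons, hsome, List.tail_cons]
    change C.Runs (e.length + 1) (some (Sum.inl q)) _ l' _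
    convert ih (S := pushAll (w x) (update S (C.src q) e)) ?_ using 1
    · rw [List.flatMap_cons, pushAll_append, pushAll_update_of_forall_ne _ (hw x),
        pushAll_update_of_forall_ne _ (hw x), update_idem]
    · rw [pushAll_apply_of_forall_ne _ (hw x), update_self]

/-- A label that moves the content of one stack onto another one, in reverse order. -/
theorem runs_transfer {q : C.Q} {l' : Option (Label M C.Q)}
    {k : Stack M E} (g : Alphabet M A (C.src q) → Alphabet M A k)
    (hsome : ∀ x, C.code q (some x) = ([⟨k, g x⟩], some (Sum.inl q)))
    (hnone : C.code q none = ([], l')) (hk : k ≠ C.src q)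
    {S S' : ∀ k, List (Alphabet M A k)} {e : List (Alphabet M A (C.src q))}
    (hS : S (C.src q) = e)
    (hS' : S' = update (update S (C.src q) []) k ((e.map g).reverse ++ S k)) :
    C.Runs (e.length + 1) (some (Sum.inl q)) S l' S' := by
  have := C.runs_move hsome hnone (fun _ => by simpa using hk) hS
  have h' (l : List (Alphabet M A (C.src q))) :
      (l.flatMap fun x => [(⟨k, g x⟩ : Σ k, Alphabet M A k)]) = l.map fun x => ⟨k, g x⟩ := by
    induction l <;> simp_all
  rw [h', pushAll_map, update_of_ne hk] at this
  rw [hS']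
  exact this

variable [Fintype J] [Fintype E]

/-- The machine of a controller, with given input and output stack. -/
noncomputable def toFinTM2 (k₀ k₁ : Stack M E) [Finite (Alphabet M A k₀)] : FinTM2 :=
  haveI : ∀ j, Fintype (M j).K := fun j => (M j).kFin
  haveI : ∀ j, Fintype (M j).Λ := fun j => (M j).ΛFin
  haveI : ∀ j, Fintype (M j).σ := fun j => (M j).σFin
  { K := Stack M E
    k₀ := k₀
    k₁ := k₁
    Γ := Alphabet M A
    Λ := Label M C.Q
    main := C.start
    σ := C.Memory
    initialState := (none, fun j => (M j).initialState)
    σFin := Fintype.ofFinite _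
    Γk₀Fin := Fintype.ofFinite _
    m := C.prog }

theorem reachesIn_toFinTM2 {k₀ k₁ : Stack M E} [Finite (Alphabet M A k₀)] {n : ℕ}
    {l : List (Alphabet M A k₀)} {l' : List (Alphabet M A k₁)}
    (h : C.Runs n (some C.start) (only k₀ l) none (only k₁ l')) :
    ReachesIn (C.toFinTM2 k₀ k₁).step n (initList (C.toFinTM2 k₀ k₁) l)
      (haltList (C.toFinTM2 k₀ k₁) l') := by
  have h₀ := initList_eq (C.toFinTM2 k₀ k₁) l
  have h₁ := haltList_eq (C.toFinTM2 k₀ k₁) l'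
  exact h₀ ▸ h₁ ▸ h

end Controller
end Controller

/-! ### Polynomially bounded quantities -/

/-- The quantity `g` is bounded by a polynomial in the size `sz`. -/
def PolyLE {α : Type} (sz g : α → ℕ) : Prop := ∃ P : Polynomial ℕ, ∀ a, g a ≤ P.eval (sz a)

theorem eval_mono (P : Polynomial ℕ) {m n : ℕ} (h : m ≤ n) : P.eval m ≤ P.eval n := by
  induction P using Polynomial.induction_on' with
  | add p q hp hq => simpa using add_le_add hp hq
  | monomial k c => simpa using Nat.mul_le_mul_left c (Nat.pow_le_pow_left h k)

namespace PolyLE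

variable {α β : Type} {sz f g : α → ℕ}

theorem self (sz : α → ℕ) : PolyLE sz sz := ⟨Polynomial.X, by simp⟩

theorem const (sz : α → ℕ) (c : ℕ) : PolyLE sz fun _ => c := ⟨Polynomial.C c, by simp⟩

theorem add (hf : PolyLE sz f) (hg : PolyLE sz g) : PolyLE sz fun a => f a + g a := by
  obtain ⟨P, hP⟩ := hf
  obtain ⟨R, hR⟩ := hg
  exact ⟨P + R, fun a => by simpa using add_le_add (hP a) (hR a)⟩

theorem mul (hf : PolyLE sz f) (hg : PolyLE sz g) : PolyLE sz fun a => f a * g a := by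
  obtain ⟨P, hP⟩ := hf
  obtain ⟨R, hR⟩ := hg
  exact ⟨P * R, fun a => by simpa using Nat.mul_le_mul (hP a) (hR a)⟩

theorem pow (hf : PolyLE sz f) (n : ℕ) : PolyLE sz fun a => f a ^ n := by
  obtain ⟨P, hP⟩ := hf
  exact ⟨P ^ n, fun a => by simpa using Nat.pow_le_pow_left (hP a) n⟩

theorem mono (hf : PolyLE sz f) (h : ∀ a, g a ≤ f a) : PolyLE sz g := by
  obtain ⟨P, hP⟩ := hf
  exact ⟨P, fun a => (h a).trans (hP a)⟩

theorem eval (hf : PolyLE sz f) (R : Polynomial ℕ) : PolyLE sz fun a => R.eval (f a) := by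
  obtain ⟨P, hP⟩ := hf
  exact ⟨R.comp P, fun a => by simpa using eval_mono R (hP a)⟩

theorem comp (hf : PolyLE sz f) (φ : β → α) : PolyLE (fun b => sz (φ b)) fun b => f (φ b) := by
  obtain ⟨P, hP⟩ := hf
  exact ⟨P, fun b => hP _⟩

end PolyLE

/-! ### Uniform computation in polynomial time -/

/-- The machine `M` turns the string `l` into the string `l'` in at most `n` steps. -/
def Outputs {Γ Δ : Type} (M : TM2ComputableAux Γ Δ) (n : ℕ) (l : List Γ) (l' : List Δ) : Prop :=
  ReachesIn M.tm.step n (initList M.tm (l.map M.inputAlphabet.symm))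
    (haltList M.tm (l'.map M.outputAlphabet.symm))

/-- One machine turns each string `I a` into the string `O a`, in time bounded by a polynomial in
the size `sz a`; the lengths of the inputs are also bounded by a polynomial in the size. The
parameter `a` need not be recoverable from `I a`, and the machine only has to work for
the parameters in `α`. -/
def FP {α Γ Δ : Type} (sz : α → ℕ) (I : α → List Γ) (O : α → List Δ) : Prop :=
  PolyLE sz (fun a => (I a).length) ∧
    ∃ (M : TM2ComputableAux Γ Δ) (t : α → ℕ), PolyLE sz t ∧ ∀ a, Outputs M (t a) (I a) (O a)

section PolyTime

variable {α β γ Γ Δ : Type} {ea : β → List Γ} {eb : γ → List Δ} {f : β → γ}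

theorem PolyTime.fp (h : PolyTime ea eb f) {sz : α → ℕ} (g : α → β)
    (hg : PolyLE sz fun a => (ea (g a)).length) :
    FP sz (fun a => ea (g a)) (fun a => eb (f (g a))) := by
  obtain ⟨M⟩ := h
  refine ⟨hg, M.toTM2ComputableAux, _, hg.eval M.time, fun a => ?_⟩
  have := M.outputsFun (g a)
  exact ⟨this.steps, this.steps_le_m, this.evals_in_steps⟩

theorem FP.polyTime (h : FP (fun b => (ea b).length) ea fun b => eb (f b)) : PolyTime ea eb f := by
  obtain ⟨-, M, t, ⟨P, hP⟩, h⟩ := h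
  exact ⟨
    { toTM2ComputableAux := M
      time := P
      outputsFun := fun b => Classical.choice <| by
        obtain ⟨m, hm, e⟩ := h b
        exact ⟨⟨⟨m, e⟩, hm.trans (hP b)⟩⟩ }⟩

end PolyTime

/-- An upper bound for the number of symbols that a statement pushes. -/
def pushBound {K : Type} {Γ : K → Type} {Λ σ : Type} : TM2.Stmt Γ Λ σ → ℕ
  | .push _ _ s => pushBound s + 1
  | .peek _ _ s => pushBound s
  | .pop _ _ s => pushBound s
  | .load _ s => pushBound s
  | .branch _ s s' => pushBound s + pushBound s'
  | .goto _ => 0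
  | .halt => 0

theorem length_stepAux_le {K : Type} [DecidableEq K] {Γ : K → Type} {Λ σ : Type}
    (s : TM2.Stmt Γ Λ σ) (v : σ) (S : ∀ k, List (Γ k)) (k : K) :
    ((TM2.stepAux s v S).stk k).length ≤ (S k).length + pushBound s := by
  induction s generalizing v S with
  | push k' f s ih =>
    refine (ih _ _).trans ?_
    rcases eq_or_ne k k' with rfl | h
    · simp [pushBound]; omega
    · simp [pushBound, h]
  | peek k' f s ih => exact ih _ _
  | pop k' f s ih =>
    refine (ih _ _).trans ?_
    rcases eq_or_ne k k' with rfl | h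
    · simp [pushBound]
    · simp [pushBound, h]
  | load f s ih => exact ih _ _
  | branch f s s' ih ih' =>
    simp only [TM2.stepAux, pushBound]
    cases f v
    · exact (ih' _ _).trans (by omega)
    · exact (ih _ _).trans (by omega)
  | goto f => simp [TM2.stepAux]
  | halt => simp [TM2.stepAux]

/-- A machine writes at most a bounded number of symbols per step, so that its output is at most
linearly longer than the input and the running time. -/
theorem exists_length_le {Γ Δ : Type} (M : TM2ComputableAux Γ Δ) : ∃ c : ℕ, ∀ n l l',
    Outputs M n l l' → l'.length ≤ l.length + c * n := by
  let inst := M.tm.ΛFin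
  refine ⟨Finset.univ.sup fun i => pushBound (M.tm.m i), fun n l l' h => ?_⟩
  have := h.le_add_mul (μ := fun c => (TM2.Cfg.stk c M.tm.k₁).length)
    (C := Finset.univ.sup fun i => pushBound (M.tm.m i)) ?_
  · rw [Controller.initList_eq, Controller.haltList_eq] at this
    simp only [only_self, List.length_map] at this
    refine this.trans (Nat.add_le_add_right ?_ _)
    by_cases h : M.tm.k₁ = M.tm.k₀
    · rw [h]; simp
    · simp [only, h]
  · rintro ⟨_ | i, v, S⟩ y hy
    · cases hy
    · simp only [FinTM2.step, TM2.step, Option.some.injEq] at hy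
      subst hy
      refine (length_stepAux_le _ _ _ _).trans (Nat.add_le_add_left ?_ _)
      exact Finset.le_sup (f := fun i => pushBound (M.tm.m i)) (Finset.mem_univ i)

namespace FP

variable {α β Γ Δ Θ : Type} {sz : α → ℕ} {I : α → List Γ} {O : α → List Δ} {O' : α → List Θ}

theorem length_input (h : FP sz I O) : PolyLE sz fun a => (I a).length := h.1

/-- The length of the output is bounded by the length of the input and the running time. -/
theorem length_output (h : FP sz I O) : PolyLE sz fun a => (O a).length := by
  obtain ⟨hI, M, t, ht, h⟩ := h
  obtain ⟨c, hc⟩ := exists_length_le M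
  exact (hI.add ((PolyLE.const sz c).mul ht)).mono fun a => hc _ _ _ (h a)

theorem comp (h : FP sz I O) (φ : β → α) :
    FP (fun b => sz (φ b)) (fun b => I (φ b)) (fun b => O (φ b)) := by
  obtain ⟨hI, M, t, ht, h⟩ := h
  exact ⟨hI.comp φ, M, _, ht.comp φ, fun b => h _⟩

theorem congr {I' : α → List Γ} {O' : α → List Δ} (h : FP sz I O) (hI : ∀ a, I a = I' a)
    (hO : ∀ a, O a = O' a) : FP sz I' O' := by
  obtain rfl : I = I' := funext hI
  obtain rfl : O = O' := funext hO
  exact h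

end FP

/-! ### Finite-state transducers -/

/-- A finite-state transducer: it reads a string from left to right, writes a string for each
symbol that it reads, and another one at the end. -/
structure Transducer (Γ Δ : Type) where
  /-- the states -/
  Q : Type
  /-- there are finitely many states -/
  [finQ : Fintype Q]
  /-- the initial state -/
  start : Q
  /-- the next state and the string to write -/
  step : Q → Γ → Q × List Δ
  /-- the string to write at the end -/
  fin : Q → List Δ

attribute [instance] Transducer.finQ

namespace Transducer

variable {Γ Δ : Type}

/-- The string written by a transducer that starts in a given state. -/
def runFrom (T : Transducer Γ Δ) : T.Q → List Γ → List Δ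
  | q, [] => T.fin q
  | q, x :: l => (T.step q x).2 ++ runFrom T (T.step q x).1 l

/-- The string written by a transducer. -/
def run (T : Transducer Γ Δ) (l : List Γ) : List Δ := T.runFrom T.start l

end Transducer

/-! ### Machines of transducers -/

/-- A controller whose runs are polynomially bounded witnesses `FP`. -/
theorem FP.of_controller {J : Type} {M : J → FinTM2} {E : Type} {A : E → Type}
    [DecidableEq J] [DecidableEq E] [Fintype J] [Fintype E] (C : Controller M A)
    {α Γ Δ : Type} [Finite Γ] {sz : α → ℕ} {I : α → List Γ} {O : α → List Δ} {k₀ k₁ : Stack M E}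
    (e₀ : Alphabet M A k₀ ≃ Γ) (e₁ : Alphabet M A k₁ ≃ Δ)
    (hI : PolyLE sz fun a => (I a).length) {t : α → ℕ} (ht : PolyLE sz t)
    (h : ∀ a, C.Runs (t a) (some C.start) (only k₀ ((I a).map e₀.symm)) none
      (only k₁ ((O a).map e₁.symm))) : FP sz I O := by
  have : Finite (Alphabet M A k₀) := Finite.of_equiv _ e₀.symm
  exact ⟨hI, ⟨C.toFinTM2 k₀ k₁, e₀, e₁⟩, t, ht, fun a => C.reachesIn_toFinTM2 (h a)⟩

theorem only_inl {J : Type} {M : J → FinTM2} {E : Type} {A : E → Type} [DecidableEq J]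
    [DecidableEq E] (x : E) (l : List (A x)) :
    (only (Sum.inl x) l : ∀ k, List (Alphabet M A k)) =
      contents (update (fun _ => []) x l) fun _ _ => [] := by
  rw [← update_contents_inl, only]
  congr 1
  funext k; rcases k with k | k <;> rfl

theorem only_inr {J : Type} {M : J → FinTM2} {E : Type} {A : E → Type} [DecidableEq J]
    [DecidableEq E] (j : J) (k : (M j).K) (l : List ((M j).Γ k)) :
    (only (Sum.inr ⟨j, k⟩) l : ∀ k, List (Alphabet M A k)) =
      contents (fun _ => []) (update (fun _ _ => []) j (only k l)) := by
  rw [only, ← update_nil_eq_only, ← update_contents_inr]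
  congr 1
  funext k; rcases k with k | k <;> rfl

/-- The alphabets of an input stack `true` and an output stack `false`. -/
abbrev InOut (Γ Δ : Type) : Bool → Type
  | true => Γ
  | false => Δ

/-- The machine of a transducer, which writes onto a stack and so reverses the string. -/
abbrev Transducer.controller {Γ Δ : Type} (T : Transducer Γ Δ) [Finite Γ] :
    Controller (fun x : Empty => x.elim) (InOut Γ Δ) where
  Q := T.Q
  src _ := Sum.inl true
  fin_src _ := ‹Finite Γ›
  code q
    | none => ((T.fin q).map fun y => ⟨Sum.inl false, y⟩, none)
    | some x => ((T.step q x).2.map fun y => ⟨Sum.inl false, y⟩, some (Sum.inl (T.step q x).1))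
  start := Sum.inl T.start

theorem Transducer.runs_controller {Γ Δ : Type} (T : Transducer Γ Δ) [Finite Γ] (q : T.Q)
    (S : ∀ k, List (Alphabet (fun x : Empty => x.elim) (InOut Γ Δ) k)) (l : List Γ)
    (hS : S (Sum.inl true) = l) :
    T.controller.Runs (l.length + 1) (some (Sum.inl q)) S none
      (update (update S (Sum.inl true) []) (Sum.inl false)
        ((T.runFrom q l).reverse ++ S (Sum.inl false))) := by
  induction l generalizing q S with
  | nil =>
    have := T.controller.runs_own (q := q) hS (w := (T.fin q).map fun y => ⟨Sum.inl false, y⟩) rfl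
    rw [pushAll_map] at this
    simpa [runFrom] using this
  | cons x l ih =>
    have := T.controller.runs_own (q := q) hS
      (w := (T.step q x).2.map fun y => ⟨Sum.inl false, y⟩) rfl
    rw [pushAll_map] at this
    have h' := this.trans (ih (T.step q x).1 _ ?_)
    · refine (?_ : T.controller.Runs _ _ _ _ _).mono (n := 1 + (l.length + 1)) (by simp; omega)
      convert h' using 1
      funext i
      rcases i with (_ | _) | ⟨⟨⟩, _⟩ <;> simp [runFrom]
    · simp

theorem FP.refl {α Γ : Type} [Finite Γ] {sz : α → ℕ} {I : α → List Γ}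
    (hI : PolyLE sz fun a => (I a).length) : FP sz I I := by
  have := Fintype.ofFinite Γ
  exact PolyTime.fp (f := id) ⟨idComputableInPolyTime (α := List Γ) (αΓ := Γ) id⟩ I hI

/-- A transducer writes its output onto a stack, on which the symbol written last comes first. -/
theorem FP.reverse_run {α Γ Δ : Type} [Finite Γ] {sz : α → ℕ} {I : α → List Γ}
    (hI : PolyLE sz fun a => (I a).length) (T : Transducer Γ Δ) :
    FP sz I fun a => (T.run (I a)).reverse := by
  refine FP.of_controller T.controller (k₀ := Sum.inl true) (k₁ := Sum.inl false)
    (Equiv.refl Γ) (Equiv.refl Δ) hI (hI.add (PolyLE.const _ 1)) fun a => ?_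
  simp only [Equiv.refl_symm, Equiv.coe_refl, List.map_id]
  convert T.runs_controller T.start _ (I a) ?_ using 1
  · simp [only, Transducer.run]
  · rw [only_self]

/-! ### Composition -/

/-- Two machines, as a family indexed by `Bool`. -/
abbrev two (M N : FinTM2) : Bool → FinTM2
  | true => M
  | false => N

/-- The stack contents of two machines. -/
def twoContents {M N : FinTM2} (m : ∀ k, List (M.Γ k)) (n : ∀ k, List (N.Γ k)) :
    ∀ j k, List ((two M N j).Γ k)
  | true => m
  | false => n

section twoContents

variable {M N : FinTM2} (m m' : ∀ k, List (M.Γ k)) (n n' : ∀ k, List (N.Γ k))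

@[simp] theorem twoContents_true : twoContents m n true = m := rfl

@[simp] theorem twoContents_false : twoContents m n false = n := rfl

@[simp] theorem update_twoContents_true :
    update (twoContents m n) true m' = twoContents m' n := by
  funext j; cases j <;> simp

@[simp] theorem update_twoContents_false :
    update (twoContents m n) false n' = twoContents m n' := by
  funext j; cases j <;> simp

end twoContents

/-- The labels of a machine that calls two machines one after the other. -/
inductive CompLabel
  | unload
  | load
  | finish
  deriving DecidableEq

instance : Fintype CompLabel :=
  ⟨{CompLabel.unload, CompLabel.load, CompLabel.finish}, by rintro ⟨⟩ <;> simp⟩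

/-- The controller that runs `M`, transfers its output to the input of `N`, and runs `N`. The
transfer goes through a stack of its own, since moving a stack onto another one reverses it. -/
abbrev compController {Γ Δ Θ : Type} [Finite Δ] (M : TM2ComputableAux Γ Δ)
    (N : TM2ComputableAux Δ Θ) : Controller (two M.tm N.tm) (fun _ : Unit => Δ) where
  Q := CompLabel
  src
    | .unload => Sum.inr ⟨true, M.tm.k₁⟩
    | .load => Sum.inl ()
    | .finish => Sum.inl ()
  fin_src
    | .unload => Finite.of_equiv Δ M.outputAlphabet.symm
    | .load => ‹Finite Δ›
    | .finish => ‹Finite Δ›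
  code
    | .unload, none => ([], some (Sum.inl .load))
    | .unload, some x => ([⟨Sum.inl (), M.outputAlphabet x⟩], some (Sum.inl .unload))
    | .load, none => ([], some (call false .finish))
    | .load, some x => ([⟨Sum.inr ⟨false, N.tm.k₀⟩, N.inputAlphabet.symm x⟩],
        some (Sum.inl .load))
    | .finish, _ => ([], none)
  start := call true .unload

theorem FP.trans {α Γ Δ Θ : Type} [Finite Γ] [Finite Δ] {sz : α → ℕ} {I : α → List Γ}
    {O : α → List Δ} {O' : α → List Θ} (h : FP sz I O) (h' : FP sz O O') : FP sz I O' := by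
  have hO := h.length_output
  obtain ⟨hI, M, t, ht, h⟩ := h
  obtain ⟨-, N, t', ht', h'⟩ := h'
  refine FP.of_controller (compController M N) (k₀ := Sum.inr ⟨true, M.tm.k₀⟩)
    (k₁ := Sum.inr ⟨false, N.tm.k₁⟩) M.inputAlphabet N.outputAlphabet hI
    (t := fun a => t a + ((O a).length + 1) + ((O a).length + 1) + t' a + 1)
    ((((ht.add (hO.add (.const _ _))).add (hO.add (.const _ _))).add ht').add (.const _ _))
    fun a => ?_
  have h₁ := (compController M N).runs_call true .unload (fun _ => []) (fun _ _ => []) (h a)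
  have h₂ := (compController M N).runs_transfer (q := .unload) (l' := some (Sum.inl .load))
    (k := Sum.inl ()) (fun x => M.outputAlphabet x) (fun _ => rfl) rfl (by simp)
    (S := contents (fun _ => [])
      (update (fun _ _ => []) true (only M.tm.k₁ ((O a).map M.outputAlphabet.symm))))
    (S' := contents (fun _ => (O a).reverse) (fun _ _ => []))
    (e := (O a).map M.outputAlphabet.symm) (by simp) (by simp; congr 1)
  have h₃ := (compController M N).runs_transfer (q := .load) (l' := some (call false .finish))
    (k := Sum.inr ⟨false, N.tm.k₀⟩) (fun x => N.inputAlphabet.symm x) (fun _ => rfl) rfl (by simp)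
    (S := contents (fun _ => (O a).reverse) (fun _ _ => []))
    (S' := contents (fun _ => [])
      (update (fun _ _ => []) false (only N.tm.k₀ ((O a).map N.inputAlphabet.symm))))
    (e := (O a).reverse) (by simp) (by simp [only]; congr 1)
  have h₄ := (compController M N).runs_call false .finish (fun _ => []) (fun _ _ => []) (h' a)
  have h₅ := (compController M N).runs_own (q := .finish) (l := []) (w := []) (l' := none)
    (S := contents (fun _ => [])
      (update (fun _ _ => []) false (only N.tm.k₁ ((O' a).map N.outputAlphabet.symm))))
    rfl rfl
  rw [List.length_map] at h₂
  rw [List.length_reverse] at h₃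
  exact ((((h₁.trans h₂).trans h₃).trans h₄).trans h₅).congr (only_inr true _ _)
    ((only_inr false _ _).trans (by simp))

/-! ### Pairing -/

/-- The pair of two strings, written in disjoint alphabets. -/
def pairStr {Γ Δ : Type} (l : List Γ) (l' : List Δ) : List (Γ ⊕ Δ) :=
  l.map Sum.inl ++ l'.map Sum.inr

/-- The stacks of a machine that applies two machines to the same string. -/
inductive PairStack
  | input
  | output
  | revInput
  | revOutput
  deriving DecidableEq

instance : Fintype PairStack :=
  ⟨{PairStack.input, PairStack.output, PairStack.revInput, PairStack.revOutput},
    by rintro ⟨⟩ <;> simp⟩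

/-- The alphabets of the own stacks of a machine that applies two machines to the same string. -/
abbrev PairStack.alphabet (Γ Δ : Type) : PairStack → Type
  | .input => Γ
  | .revInput => Γ
  | .output => Δ
  | .revOutput => Δ

/-- The contents of the own stacks of a machine that applies two machines to the same string. -/
def pairContents {Γ Δ : Type} (i : List Γ) (o : List Δ) (i' : List Γ) (o' : List Δ) :
    ∀ x, List (PairStack.alphabet Γ Δ x)
  | .input => i
  | .output => o
  | .revInput => i'
  | .revOutput => o'

section pairContents

variable {Γ Δ : Type} (i i' j : List Γ) (o o' p : List Δ)

@[simp] theorem update_pairContents_input :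
    update (pairContents i o i' o') .input j = pairContents j o i' o' := by
  funext x; cases x <;> simp [pairContents]

@[simp] theorem update_pairContents_output :
    update (pairContents i o i' o') .output p = pairContents i p i' o' := by
  funext x; cases x <;> simp [pairContents]

@[simp] theorem update_pairContents_revInput :
    update (pairContents i o i' o') .revInput j = pairContents i o j o' := by
  funext x; cases x <;> simp [pairContents]

@[simp] theorem update_pairContents_revOutput :
    update (pairContents i o i' o') .revOutput p = pairContents i o i' p := by
  funext x; cases x <;> simp [pairContents]

theorem pairContents_nil :
    pairContents ([] : List Γ) ([] : List Δ) [] [] = fun _ => [] := by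
  funext x; cases x <;> rfl

end pairContents

theorem twoContents_nil {M N : FinTM2} :
    twoContents (M := M) (N := N) (fun _ => []) (fun _ => []) = fun _ _ => [] := by
  funext x; cases x <;> rfl

/-- The labels of a machine that applies two machines to the same string. -/
inductive PairLabel
  | unload
  | load
  | callSecond
  | unloadSecond
  | writeSecond
  | unloadFirst
  | writeFirst
  deriving DecidableEq

instance : Fintype PairLabel :=
  ⟨{PairLabel.unload, PairLabel.load, PairLabel.callSecond, PairLabel.unloadSecond,
    PairLabel.writeSecond, PairLabel.unloadFirst, PairLabel.writeFirst}, by rintro ⟨⟩ <;> simp⟩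

/-- The controller that copies its input to the inputs of `M` and of `N`, runs both, and writes
their outputs one after the other. Since an output stack is written from the bottom, the output of
`N` is transferred first. -/
abbrev pairController {Γ Δ Θ : Type} [Finite Γ] [Finite Δ] [Finite Θ] (M : TM2ComputableAux Γ Δ)
    (N : TM2ComputableAux Γ Θ) : Controller (two M.tm N.tm) (PairStack.alphabet Γ (Δ ⊕ Θ)) where
  Q := PairLabel
  src
    | .unload => Sum.inl .input
    | .load => Sum.inl .revInput
    | .callSecond => Sum.inl .input
    | .unloadSecond => Sum.inr ⟨false, N.tm.k₁⟩
    | .writeSecond => Sum.inl .revOutput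
    | .unloadFirst => Sum.inr ⟨true, M.tm.k₁⟩
    | .writeFirst => Sum.inl .revOutput
  fin_src
    | .unload => ‹Finite Γ›
    | .load => ‹Finite Γ›
    | .callSecond => ‹Finite Γ›
    | .unloadSecond => Finite.of_equiv Θ N.outputAlphabet.symm
    | .writeSecond => inferInstanceAs (Finite (Δ ⊕ Θ))
    | .unloadFirst => Finite.of_equiv Δ M.outputAlphabet.symm
    | .writeFirst => inferInstanceAs (Finite (Δ ⊕ Θ))
  code
    | .unload, none => ([], some (Sum.inl .load))
    | .unload, some x => ([⟨Sum.inl .revInput, x⟩], some (Sum.inl .unload))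
    | .load, none => ([], some (call true .callSecond))
    | .load, some x => ([⟨Sum.inr ⟨true, M.tm.k₀⟩, M.inputAlphabet.symm x⟩,
        ⟨Sum.inr ⟨false, N.tm.k₀⟩, N.inputAlphabet.symm x⟩], some (Sum.inl .load))
    | .callSecond, _ => ([], some (call false .unloadSecond))
    | .unloadSecond, none => ([], some (Sum.inl .writeSecond))
    | .unloadSecond, some x => ([⟨Sum.inl .revOutput, Sum.inr (N.outputAlphabet x)⟩],
        some (Sum.inl .unloadSecond))
    | .writeSecond, none => ([], some (Sum.inl .unloadFirst))
    | .writeSecond, some x => ([⟨Sum.inl .output, x⟩], some (Sum.inl .writeSecond))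
    | .unloadFirst, none => ([], some (Sum.inl .writeFirst))
    | .unloadFirst, some x => ([⟨Sum.inl .revOutput, Sum.inl (M.outputAlphabet x)⟩],
        some (Sum.inl .unloadFirst))
    | .writeFirst, none => ([], none)
    | .writeFirst, some x => ([⟨Sum.inl .output, x⟩], some (Sum.inl .writeFirst))
  start := Sum.inl .unload

theorem FP.pair {α Γ Δ Θ : Type} [Finite Γ] [Finite Δ] [Finite Θ] {sz : α → ℕ} {I : α → List Γ}
    {O : α → List Δ} {O' : α → List Θ} (h : FP sz I O) (h' : FP sz I O') :
    FP sz I fun a => pairStr (O a) (O' a) := by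
  have hO := h.length_output
  have hO' := h'.length_output
  obtain ⟨hI, M, t, ht, h⟩ := h
  obtain ⟨-, N, t', ht', h'⟩ := h'
  refine FP.of_controller (pairController M N) (k₀ := Sum.inl .input) (k₁ := Sum.inl .output)
    (Equiv.refl Γ) (Equiv.refl (Δ ⊕ Θ)) hI
    (t := fun a => (((((((I a).length + 1) + ((I a).length + 1) + t a) + 1) + t' a)
      + ((O' a).length + 1) + ((O' a).length + 1)) + ((O a).length + 1)) + ((O a).length + 1))
    ?_ fun a => ?_
  · repeat' first
      | exact hI | exact ht | exact ht' | exact hO | exact hO' | exact .const _ _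
      | refine PolyLE.add ?_ ?_
  simp only [Equiv.refl_symm, Equiv.coe_refl, List.map_id]
  let C := pairController M N
  let S (i o i' o' m n) : ∀ k, List (Alphabet (two M.tm N.tm) (PairStack.alphabet Γ (Δ ⊕ Θ)) k) :=
    contents (pairContents i o i' o') (twoContents m n)
  have h₁ : C.Runs ((I a).length + 1) (some (Sum.inl .unload))
      (S (I a) [] [] [] (fun _ => []) (fun _ => [])) (some (Sum.inl .load))
      (S [] [] (I a).reverse [] (fun _ => []) (fun _ => [])) :=
    C.runs_transfer (q := .unload) (k := Sum.inl .revInput) id (fun _ => rfl) rfl (by simp [C])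
      rfl (by simp [S, C, pairContents])
  have h₂ : C.Runs ((I a).length + 1) (some (Sum.inl .load))
      (S [] [] (I a).reverse [] (fun _ => []) (fun _ => [])) (some (call true .callSecond))
      (S [] [] [] [] (only M.tm.k₀ ((I a).map M.inputAlphabet.symm))
        (only N.tm.k₀ ((I a).map N.inputAlphabet.symm))) := by
    have := C.runs_move (q := .load) (l' := some (call true .callSecond)) (w' := [])
      (w := fun x => [⟨Sum.inr ⟨true, M.tm.k₀⟩, M.inputAlphabet.symm x⟩,
        ⟨Sum.inr ⟨false, N.tm.k₀⟩, N.inputAlphabet.symm x⟩])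
      (S := S [] [] (I a).reverse [] (fun _ => []) (fun _ => [])) (fun _ => rfl) rfl (by simp)
      (e := (I a).reverse) rfl
    rw [List.length_reverse] at this
    refine this.congr rfl ?_
    rw [pushAll_nil, pushAll_flatMap_pair (by simp)]
    simp [S, C, only]
  have h₃ : C.Runs (t a) (some (call true .callSecond))
      (S [] [] [] [] (only M.tm.k₀ ((I a).map M.inputAlphabet.symm))
        (only N.tm.k₀ ((I a).map N.inputAlphabet.symm))) (some (Sum.inl .callSecond))
      (S [] [] [] [] (only M.tm.k₁ ((O a).map M.outputAlphabet.symm))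
        (only N.tm.k₀ ((I a).map N.inputAlphabet.symm))) :=
    (C.runs_call true .callSecond (pairContents [] [] [] [])
      (twoContents (fun _ => []) (only N.tm.k₀ ((I a).map N.inputAlphabet.symm))) (h a)).congr
      (by simp [S]) (by simp [S])
  have h₄ : C.Runs 1 (some (Sum.inl .callSecond))
      (S [] [] [] [] (only M.tm.k₁ ((O a).map M.outputAlphabet.symm))
        (only N.tm.k₀ ((I a).map N.inputAlphabet.symm))) (some (call false .unloadSecond))
      (S [] [] [] [] (only M.tm.k₁ ((O a).map M.outputAlphabet.symm))
        (only N.tm.k₀ ((I a).map N.inputAlphabet.symm))) :=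
    (C.runs_own (q := .callSecond) (l := []) (w := []) rfl rfl).congr rfl (by simp [S, C])
  have h₅ : C.Runs (t' a) (some (call false .unloadSecond))
      (S [] [] [] [] (only M.tm.k₁ ((O a).map M.outputAlphabet.symm))
        (only N.tm.k₀ ((I a).map N.inputAlphabet.symm))) (some (Sum.inl .unloadSecond))
      (S [] [] [] [] (only M.tm.k₁ ((O a).map M.outputAlphabet.symm))
        (only N.tm.k₁ ((O' a).map N.outputAlphabet.symm))) :=
    (C.runs_call false .unloadSecond (pairContents [] [] [] [])
      (twoContents (only M.tm.k₁ ((O a).map M.outputAlphabet.symm)) (fun _ => [])) (h' a)).congr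
      (by simp [S]) (by simp [S])
  have h₆ : C.Runs (((O' a).map N.outputAlphabet.symm).length + 1) (some (Sum.inl .unloadSecond))
      (S [] [] [] [] (only M.tm.k₁ ((O a).map M.outputAlphabet.symm))
        (only N.tm.k₁ ((O' a).map N.outputAlphabet.symm))) (some (Sum.inl .writeSecond))
      (S [] [] [] ((O' a).map Sum.inr).reverse
        (only M.tm.k₁ ((O a).map M.outputAlphabet.symm)) (fun _ => [])) :=
    C.runs_transfer (q := .unloadSecond) (k := Sum.inl .revOutput)
      (fun x => Sum.inr (N.outputAlphabet x)) (fun _ => rfl) rfl (by simp [C]) (by simp [S, C])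
      (by simp [S, C, Function.comp_def, pairContents])
  have h₇ : C.Runs (((O' a).map Sum.inr).reverse.length + 1) (some (Sum.inl .writeSecond))
      (S [] [] [] ((O' a).map Sum.inr).reverse
        (only M.tm.k₁ ((O a).map M.outputAlphabet.symm)) (fun _ => []))
      (some (Sum.inl .unloadFirst))
      (S [] ((O' a).map Sum.inr) [] [] (only M.tm.k₁ ((O a).map M.outputAlphabet.symm))
        (fun _ => [])) :=
    C.runs_transfer (q := .writeSecond) (k := Sum.inl .output) id (fun _ => rfl) rfl (by simp [C])
      rfl (by simp [S, C, pairContents])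
  have h₈ : C.Runs (((O a).map M.outputAlphabet.symm).length + 1) (some (Sum.inl .unloadFirst))
      (S [] ((O' a).map Sum.inr) [] [] (only M.tm.k₁ ((O a).map M.outputAlphabet.symm))
        (fun _ => [])) (some (Sum.inl .writeFirst))
      (S [] ((O' a).map Sum.inr) [] ((O a).map Sum.inl).reverse (fun _ => []) (fun _ => [])) :=
    C.runs_transfer (q := .unloadFirst) (k := Sum.inl .revOutput)
      (fun x => Sum.inl (M.outputAlphabet x)) (fun _ => rfl) rfl (by simp [C]) (by simp [S, C])
      (by simp [S, C, Function.comp_def, pairContents])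
  have h₉ : C.Runs (((O a).map Sum.inl).reverse.length + 1) (some (Sum.inl .writeFirst))
      (S [] ((O' a).map Sum.inr) [] ((O a).map Sum.inl).reverse (fun _ => []) (fun _ => [])) none
      (S [] (pairStr (O a) (O' a)) [] [] (fun _ => []) (fun _ => [])) :=
    C.runs_transfer (q := .writeFirst) (k := Sum.inl .output) id (fun _ => rfl) rfl (by simp [C])
      rfl (by simp [S, C, pairStr, pairContents])
  simp only [List.length_reverse, List.length_map] at h₂ h₆ h₇ h₈ h₉
  refine ((((((((h₁.trans h₂).trans h₃).trans h₄).trans h₅).trans h₆).trans h₇).trans h₈).trans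
    h₉).congr ?_ ?_
  · refine (only_inl (M := two M.tm N.tm) (A := PairStack.alphabet Γ (Δ ⊕ Θ)) .input (I a)).trans ?_
    simp [S, ← pairContents_nil, ← twoContents_nil]
  · refine (only_inl (M := two M.tm N.tm) (A := PairStack.alphabet Γ (Δ ⊕ Θ)) .output
      (pairStr (O a) (O' a))).trans ?_
    simp [S, ← pairContents_nil, ← twoContents_nil]

/-! ### Bounded iteration -/

/-- The stacks of a machine that iterates another one. -/
inductive LoopStack
  | input
  | counter
  | temp
  deriving DecidableEq

instance : Fintype LoopStack :=
  ⟨{LoopStack.input, LoopStack.counter, LoopStack.temp}, by rintro ⟨⟩ <;> simp⟩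

/-- The alphabets of the own stacks of a machine that iterates another one. -/
abbrev LoopStack.alphabet (Υ Γ : Type) : LoopStack → Type
  | .input => Υ ⊕ Γ
  | .counter => Υ
  | .temp => Γ

/-- The contents of the own stacks of a machine that iterates another one. -/
def loopContents {Υ Γ : Type} (i : List (Υ ⊕ Γ)) (c : List Υ) (l : List Γ) :
    ∀ x, List (LoopStack.alphabet Υ Γ x)
  | .input => i
  | .counter => c
  | .temp => l

section loopContents

variable {Υ Γ : Type} (i i' : List (Υ ⊕ Γ)) (c c' : List Υ) (l l' : List Γ)

@[simp] theorem update_loopContents_input :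
    update (loopContents i c l) .input i' = loopContents i' c l := by
  funext x; cases x <;> simp [loopContents]

@[simp] theorem update_loopContents_counter :
    update (loopContents i c l) .counter c' = loopContents i c' l := by
  funext x; cases x <;> simp [loopContents]

@[simp] theorem update_loopContents_temp :
    update (loopContents i c l) .temp l' = loopContents i c l' := by
  funext x; cases x <;> simp [loopContents]

theorem loopContents_nil : loopContents ([] : List (Υ ⊕ Γ)) [] [] = fun _ => [] := by
  funext x; cases x <;> rfl

end loopContents

/-- The labels of a machine that iterates another one. -/
inductive LoopLabel
  | unload
  | load
  | test
  | save
  deriving DecidableEq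

instance : Fintype LoopLabel :=
  ⟨{LoopLabel.unload, LoopLabel.load, LoopLabel.test, LoopLabel.save}, by rintro ⟨⟩ <;> simp⟩

/-- The controller that splits its input into a counter and a string, and applies `M` to the string
once for each symbol of the counter. The result is left on the input stack of `M`. -/
abbrev loopController {Υ Γ : Type} [Finite Υ] [Finite Γ] (M : TM2ComputableAux Γ Γ) :
    Controller (fun _ : Unit => M.tm) (LoopStack.alphabet Υ Γ) where
  Q := LoopLabel
  src
    | .unload => Sum.inl .input
    | .load => Sum.inl .temp
    | .test => Sum.inl .counter
    | .save => Sum.inr ⟨(), M.tm.k₁⟩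
  fin_src
    | .unload => inferInstanceAs (Finite (Υ ⊕ Γ))
    | .load => ‹Finite Γ›
    | .test => ‹Finite Υ›
    | .save => Finite.of_equiv Γ M.outputAlphabet.symm
  code
    | .unload, none => ([], some (Sum.inl .load))
    | .unload, some (Sum.inl x) => ([⟨Sum.inl .counter, x⟩], some (Sum.inl .unload))
    | .unload, some (Sum.inr x) => ([⟨Sum.inl .temp, x⟩], some (Sum.inl .unload))
    | .load, none => ([], some (Sum.inl .test))
    | .load, some x => ([⟨Sum.inr ⟨(), M.tm.k₀⟩, M.inputAlphabet.symm x⟩], some (Sum.inl .load))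
    | .test, none => ([], none)
    | .test, some _ => ([], some (call () .save))
    | .save, none => ([], some (Sum.inl .load))
    | .save, some x => ([⟨Sum.inl .temp, M.outputAlphabet x⟩], some (Sum.inl .save))
  start := Sum.inl .unload

/-- A machine that turns `St i` into `St (i + 1)` for all `i < n` can be iterated to turn `St i`
into `St n`. -/
theorem runs_loopController {Υ Γ : Type} [Finite Υ] [Finite Γ] (M : TM2ComputableAux Γ Γ)
    {St : ℕ → List Γ} {n t B : ℕ} (h : ∀ i < n, Outputs M t (St i) (St (i + 1)))
    (hB : ∀ i ≤ n, (St i).length ≤ B) (i : ℕ) (c : List Υ) (hc : i + c.length = n) :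
    (loopController M).Runs ((c.length + 1) * (t + 2 * B + 3)) (some (Sum.inl .load))
      (contents (loopContents [] c (St i).reverse) (fun _ _ => [])) none
      (contents (loopContents [] [] [])
        (fun _ => only M.tm.k₀ ((St n).map M.inputAlphabet.symm))) := by
  let C := loopController (Υ := Υ) M
  have h₁ (i : ℕ) (c : List Υ) : C.Runs ((St i).reverse.length + 1) (some (Sum.inl .load))
      (contents (loopContents [] c (St i).reverse) (fun _ _ => [])) (some (Sum.inl .test))
      (contents (loopContents [] c [])
        (fun _ => only M.tm.k₀ ((St i).map M.inputAlphabet.symm))) :=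
    C.runs_transfer (q := .load) (k := Sum.inr ⟨(), M.tm.k₀⟩) (fun x => M.inputAlphabet.symm x)
      (fun _ => rfl) rfl (by simp [C]) rfl
      (by simp [C, only]; congr 1)
  simp only [List.length_reverse] at h₁
  induction c generalizing i with
  | nil =>
    obtain rfl : i = n := by simpa using hc
    have h₂ := C.runs_own (q := .test) (l := []) (w := []) (l' := none)
      (S := contents (loopContents [] [] [])
        (fun _ => only M.tm.k₀ ((St i).map M.inputAlphabet.symm))) rfl rfl
    refine (((h₁ i []).trans h₂).mono ?_).congr rfl ?_
    · have := hB i le_rfl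
      simp; omega
    · simp [C]
  | cons x c ih =>
    have hi : i < n := by simp at hc; omega
    have h₂ : C.Runs 1 (some (Sum.inl .test)) (contents (loopContents [] (x :: c) [])
        (fun _ => only M.tm.k₀ ((St i).map M.inputAlphabet.symm))) (some (call () .save))
        (contents (loopContents [] c [])
        (fun _ => only M.tm.k₀ ((St i).map M.inputAlphabet.symm))) :=
      (C.runs_own (q := .test) (l := x :: c) (w := []) rfl rfl).congr rfl (by simp [C])
    have h₃ : C.Runs t (some (call () .save)) (contents (loopContents [] c [])
        (fun _ => only M.tm.k₀ ((St i).map M.inputAlphabet.symm))) (some (Sum.inl .save))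
        (contents (loopContents [] c [])
        (fun _ => only M.tm.k₁ ((St (i + 1)).map M.outputAlphabet.symm))) :=
      (C.runs_call () .save (loopContents [] c []) (fun _ _ => []) (h i hi)).congr
        (by congr 1) (by congr 1)
    have h₄ : C.Runs (((St (i + 1)).map M.outputAlphabet.symm).length + 1) (some (Sum.inl .save))
        (contents (loopContents [] c [])
        (fun _ => only M.tm.k₁ ((St (i + 1)).map M.outputAlphabet.symm))) (some (Sum.inl .load))
        (contents (loopContents [] c (St (i + 1)).reverse) (fun _ _ => [])) :=
      C.runs_transfer (q := .save) (k := Sum.inl .temp) (fun x => M.outputAlphabet x)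
        (fun _ => rfl) rfl (by simp [C]) (by simp [C]) (by simp [C, loopContents]; congr 1)
    rw [List.length_map] at h₄
    refine (((((h₁ i (x :: c)).trans h₂).trans h₃).trans h₄).trans
      (ih (i + 1) (by simp at hc; omega))).mono ?_
    have := hB i hi.le
    have := hB (i + 1) hi
    simp only [List.length_cons, Nat.add_mul]
    omega

/-- Bounded iteration: from a counter `U a` and a string `St a 0`, the string `St a n` can be
computed, where `n` is the length of the counter, if there is a machine that turns `St a i` into
`St a (i + 1)` for `i < n` and the lengths of these strings are polynomially bounded. -/
theorem FP.loop {α Γ Υ Δ : Type} [Finite Γ] [Finite Υ] [Finite Δ] {sz : α → ℕ} {I : α → List Δ}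
    {U : α → List Υ} {St : α → ℕ → List Γ} (hU : FP sz I U) (h₀ : FP sz I fun a => St a 0)
    (hs : FP (fun x : {x : α × ℕ // x.2 < (U x.1).length} => sz x.1.1) (fun x => St x.1.1 x.1.2)
      fun x => St x.1.1 (x.1.2 + 1))
    {B : α → ℕ} (hB : PolyLE sz B) (hSt : ∀ a, ∀ i ≤ (U a).length, (St a i).length ≤ B a) :
    FP sz I fun a => St a (U a).length := by
  refine (hU.pair h₀).trans ?_
  have hP := (hU.pair h₀).length_output
  have hU' := hU.length_output
  obtain ⟨-, M, t, ⟨P, ht⟩, h⟩ := hs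
  refine FP.of_controller (loopController M) (k₀ := Sum.inl .input)
    (k₁ := Sum.inr ⟨(), M.tm.k₀⟩) (Equiv.refl (Υ ⊕ Γ)) M.inputAlphabet hP
    (t := fun a => ((pairStr (U a) (St a 0)).length + 1) +
      ((U a).length + 1) * (P.eval (sz a) + 2 * B a + 3)) ?_ fun a => ?_
  · exact (hP.add (.const _ _)).add ((hU'.add (.const _ _)).mul ((((PolyLE.self sz).eval P).add
      ((PolyLE.const _ 2).mul hB)).add (.const _ _)))
  simp only [Equiv.refl_symm, Equiv.coe_refl, List.map_id]
  let C := loopController (Υ := Υ) M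
  have h₁ : C.Runs ((pairStr (U a) (St a 0)).length + 1) (some (Sum.inl .unload))
      (contents (loopContents (pairStr (U a) (St a 0)) [] []) (fun _ _ => []))
      (some (Sum.inl .load))
      (contents (loopContents [] (U a).reverse (St a 0).reverse) (fun _ _ => [])) := by
    have := C.runs_move (q := .unload) (w' := []) (l' := some (Sum.inl .load))
      (w := fun | Sum.inl x => [⟨Sum.inl .counter, x⟩] | Sum.inr x => [⟨Sum.inl .temp, x⟩])
      (S := contents (loopContents (pairStr (U a) (St a 0)) [] []) (fun _ _ => []))
      (by rintro (_ | _) <;> rfl) rfl (by rintro (_ | _) <;> simp [C])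
      (e := pairStr (U a) (St a 0)) rfl
    refine this.congr rfl ?_
    simp only [pushAll_nil, pairStr, List.flatMap_append, List.flatMap_map, pushAll_append]
    have h₁ (l : List Υ) : (l.flatMap fun x => [(⟨Sum.inl .counter, x⟩ :
        Σ k, Alphabet (fun _ : Unit => M.tm) (LoopStack.alphabet Υ Γ) k)]) =
        l.map fun x => ⟨Sum.inl .counter, x⟩ := by
      induction l <;> simp_all
    have h₂ (l : List Γ) : (l.flatMap fun x => [(⟨Sum.inl .temp, x⟩ :
        Σ k, Alphabet (fun _ : Unit => M.tm) (LoopStack.alphabet Υ Γ) k)]) =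
        l.map fun x => ⟨Sum.inl .temp, x⟩ := by
      induction l <;> simp_all
    rw [h₁, h₂, pushAll_map, pushAll_map]
    simp [C, loopContents]
  have h₂ := runs_loopController M (St := St a) (n := (U a).length) (t := P.eval (sz a)) (B := B a)
    (fun i hi => (h ⟨(a, i), hi⟩).mono (ht ⟨(a, i), hi⟩)) (hSt a) 0 (U a).reverse (by simp)
  rw [List.length_reverse] at h₂
  refine (h₁.trans h₂).congr ?_ ?_
  · refine (only_inl (M := fun _ : Unit => M.tm) (A := LoopStack.alphabet Υ Γ) .input
      (pairStr (U a) (St a 0))).trans ?_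
    simp [← loopContents_nil]
  · refine (only_inr (M := fun _ : Unit => M.tm) (A := LoopStack.alphabet Υ Γ) () M.tm.k₀
      _).trans ?_
    rw [← loopContents_nil]
    congr 1

/-! ### String functions computable in polynomial time -/

/-- The transducer that replaces each symbol by a string. -/
def Transducer.subst {Γ Δ : Type} (f : Γ → List Δ) : Transducer Γ Δ where
  Q := Unit
  start := ()
  step _ x := ((), f x)
  fin _ := []

theorem Transducer.run_subst {Γ Δ : Type} (f : Γ → List Δ) (l : List Γ) :
    (Transducer.subst f).run l = l.flatMap f := by
  have (q : Unit) : (Transducer.subst f).runFrom q l = l.flatMap f := by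
    induction l with
    | nil => rfl
    | cons x l ih => rw [List.flatMap_cons, ← ih]; rfl
  exact this _

/-- The transducer that writes a fixed string. -/
def Transducer.const {Γ Δ : Type} (l : List Δ) : Transducer Γ Δ where
  Q := Unit
  start := ()
  step _ _ := ((), [])
  fin _ := l

theorem Transducer.run_const {Γ Δ : Type} (l : List Δ) (l' : List Γ) :
    (Transducer.const l).run l' = l := by
  have (q : Unit) : (Transducer.const (Γ := Γ) l).runFrom q l' = l := by
    induction l' with
    | nil => rfl
    | cons x l' ih => exact ih
  exact this _

/-- The transducer that drops the longest prefix of symbols satisfying `p`. -/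
def Transducer.dropWhile {Γ : Type} (p : Γ → Bool) : Transducer Γ Γ where
  Q := Bool
  start := true
  step q x := if q && p x then (true, []) else (false, [x])
  fin _ := []

theorem Transducer.run_dropWhile {Γ : Type} (p : Γ → Bool) (l : List Γ) :
    (Transducer.dropWhile p).run l = l.dropWhile p := by
  have h (l : List Γ) : (Transducer.dropWhile p).runFrom false l = l := by
    induction l with
    | nil => rfl
    | cons x l ih => exact congrArg (x :: ·) ih
  change (Transducer.dropWhile p).runFrom true l = _
  induction l with
  | nil => rfl
  | cons x l ih =>
    have e : (Transducer.dropWhile p).runFrom true (x :: l) =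
      ((Transducer.dropWhile p).step true x).2 ++
        (Transducer.dropWhile p).runFrom ((Transducer.dropWhile p).step true x).1 l := rfl
    rw [e, List.dropWhile_cons]
    by_cases hx : p x
    · simpa [Transducer.dropWhile, hx] using ih
    · simpa [Transducer.dropWhile, hx] using h l

/-- The transducer that keeps only the longest prefix of symbols satisfying `p`. -/
def Transducer.takeWhile {Γ : Type} (p : Γ → Bool) : Transducer Γ Γ where
  Q := Bool
  start := true
  step q x := if q && p x then (true, [x]) else (false, [])
  fin _ := []

theorem Transducer.run_takeWhile {Γ : Type} (p : Γ → Bool) (l : List Γ) :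
    (Transducer.takeWhile p).run l = l.takeWhile p := by
  have h (l : List Γ) : (Transducer.takeWhile p).runFrom false l = [] := by
    induction l with
    | nil => rfl
    | cons x l ih => exact ih
  change (Transducer.takeWhile p).runFrom true l = _
  induction l with
  | nil => rfl
  | cons x l ih =>
    have e : (Transducer.takeWhile p).runFrom true (x :: l) =
      ((Transducer.takeWhile p).step true x).2 ++
        (Transducer.takeWhile p).runFrom ((Transducer.takeWhile p).step true x).1 l := rfl
    rw [e, List.takeWhile_cons]
    by_cases hx : p x
    · simpa [Transducer.takeWhile, hx] using ih
    · simpa [Transducer.takeWhile, hx] using h l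

namespace FP

variable {α Γ Δ Θ : Type} [Finite Γ] [Finite Δ] [Finite Θ] {sz : α → ℕ} {I : α → List Γ}
  {O : α → List Δ} {O' : α → List Θ}

theorem reverse (h : FP sz I O) : FP sz I fun a => (O a).reverse := by
  refine (h.trans (reverse_run h.length_output (Transducer.subst fun x => [x]))).congr
    (fun _ => rfl) fun a => ?_
  rw [Transducer.run_subst, List.flatMap_singleton']

theorem run (h : FP sz I O) (T : Transducer Δ Θ) : FP sz I fun a => T.run (O a) :=
  (h.trans (reverse_run h.length_output T)).reverse.congr (fun _ => rfl) fun a => by simp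

theorem flatMap (h : FP sz I O) (f : Δ → List Θ) : FP sz I fun a => (O a).flatMap f :=
  (h.run (Transducer.subst f)).congr (fun _ => rfl) fun _ => Transducer.run_subst f _

theorem map (h : FP sz I O) (f : Δ → Θ) : FP sz I fun a => (O a).map f :=
  (h.flatMap fun x => [f x]).congr (fun _ => rfl) fun a => by
    induction O a <;> simp_all

theorem filterMap (h : FP sz I O) (f : Δ → Option Θ) : FP sz I fun a => (O a).filterMap f :=
  (h.flatMap fun x => (f x).toList).congr (fun _ => rfl) fun a => by
    induction O a with
    | nil => rfl
    | cons x l ih => cases hx : f x <;> simp_all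

theorem filter (h : FP sz I O) (p : Δ → Bool) : FP sz I fun a => (O a).filter p :=
  (h.filterMap (Option.guard fun x => p x)).congr (fun _ => rfl) fun a => by simp

theorem const (hI : PolyLE sz fun a => (I a).length) (l : List Θ) : FP sz I fun _ => l :=
  ((FP.refl hI).run (Transducer.const l)).congr (fun _ => rfl) fun _ => Transducer.run_const _ _

theorem left {O' : α → List Θ} (h : FP sz I fun a => pairStr (O a) (O' a)) : FP sz I O :=
  (h.filterMap Sum.getLeft?).congr (fun _ => rfl) fun a => by
    simp [pairStr, List.filterMap_map, Function.comp_def]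

theorem right {O' : α → List Θ} (h : FP sz I fun a => pairStr (O a) (O' a)) : FP sz I O' :=
  (h.filterMap Sum.getRight?).congr (fun _ => rfl) fun a => by
    simp [pairStr, List.filterMap_map, Function.comp_def]

theorem append {O' : α → List Δ} (h : FP sz I O) (h' : FP sz I O') :
    FP sz I fun a => O a ++ O' a :=
  ((h.pair h').map (Sum.elim id id)).congr (fun _ => rfl) fun a => by simp [pairStr]

theorem rdropWhile (h : FP sz I O) (p : Δ → Bool) : FP sz I fun a => (O a).rdropWhile p :=
  (h.reverse.run (Transducer.dropWhile p)).reverse.congr (fun _ => rfl) fun a => by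
    rw [Transducer.run_dropWhile, List.rdropWhile]

theorem rtakeWhile (h : FP sz I O) (p : Δ → Bool) : FP sz I fun a => (O a).rtakeWhile p :=
  (h.reverse.run (Transducer.takeWhile p)).reverse.congr (fun _ => rfl) fun a => by
    rw [Transducer.run_takeWhile, List.rtakeWhile]

/-- The iterates of a string function computed by a transducer, with a counter given by the length
of a string. -/
theorem iterate (T : Transducer Δ Δ) {U : α → List Θ} (hU : FP sz I U) (h : FP sz I O)
    {B : α → ℕ} (hB : PolyLE sz B) (hT : ∀ a, ∀ i ≤ (U a).length, (T.run^[i] (O a)).length ≤ B a) :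
    FP sz I fun a => T.run^[(U a).length] (O a) := by
  refine FP.loop (St := fun a i => T.run^[i] (O a)) hU h ?_ hB hT
  have hl : PolyLE (fun x : {x : α × ℕ // x.2 < (U x.1).length} => sz x.1.1)
      fun x => (T.run^[x.1.2] (O x.1.1)).length :=
    (hB.comp fun x : {x : α × ℕ // x.2 < (U x.1).length} => x.1.1).mono fun x => hT _ _ x.2.le
  exact ((FP.refl hl).run T).congr (fun _ => rfl) fun x => (iterate_succ_apply' _ _ _).symm

/-- A conditional: to decide `c a`, and then `r a` if `c a` holds, it suffices to have a machine
that decides `r a` for those `a` for which `c a` holds. -/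
theorem guard {c : α → Bool} {r : {a // c a = true} → Bool} (hc : FP sz I fun a => [c a])
    (hr : FP (fun a : {a // c a = true} => sz a) (fun a => I a) fun a => [r a]) :
    FP sz I fun a => [if h : c a = true then r ⟨a, h⟩ else false] := by
  let St (a : α) (i : ℕ) : List (Γ ⊕ Bool) :=
    if i = 0 then pairStr (I a) [] else if h : c a = true then pairStr [] [r ⟨a, h⟩] else []
  have hI := hc.length_input
  have h := FP.loop (St := St) (I := I) (hc.filter id)
    (((FP.refl hI).pair (const hI ([] : List Bool))).congr (fun _ => rfl) fun a => by simp [St])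
    ?_ (hI.add (.const _ 1)) (fun a i _ => ?_)
  · let T : Transducer (Γ ⊕ Bool) Bool :=
      { Q := Bool
        start := false
        step := fun q x => x.elim (fun _ => (q, [])) fun b => (true, [b])
        fin := fun q => if q then [] else [false] }
    refine (h.run T).congr (fun _ => rfl) fun a => ?_
    by_cases h : c a = true
    · simp [St, h, pairStr, Transducer.run, Transducer.runFrom, T]
    · have (l : List Γ) : T.runFrom false (l.map Sum.inl) = [false] := by
        induction l with
        | nil => rfl
        | cons x l ih => exact ih
      simpa [St, h, pairStr] using! this (I a)
  · -- the body of the loop is only reached for those `a` for which `c a` holds, and only once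
    have hx (x : {x : α × ℕ // x.2 < ([c x.1].filter id).length}) : c x.1.1 = true ∧ x.1.2 = 0 := by
      obtain ⟨⟨a, i⟩, hx⟩ := x
      by_cases h : c a = true <;> simp [h] at hx ⊢
      exact hx
    have hr' := hr.comp fun x : {x : α × ℕ // x.2 < ([c x.1].filter id).length} =>
      (⟨x.1.1, (hx x).1⟩ : {a // c a = true})
    have hl : PolyLE (fun x : {x : α × ℕ // x.2 < ([c x.1].filter id).length} => sz x.1.1)
        fun x => (St x.1.1 x.1.2).length :=
      hr'.length_input.mono fun x => by simp [St, (hx x).2, pairStr]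
    have h₁ : FP (fun x : {x : α × ℕ // x.2 < ([c x.1].filter id).length} => sz x.1.1)
        (fun x => St x.1.1 x.1.2) fun x => I x.1.1 :=
      left (O' := fun _ => ([] : List Bool)) <| (FP.refl hl).congr (fun _ => rfl) fun x => by
        simp [St, (hx x).2]
    have h₂ := h₁.trans hr'
    exact ((const hl ([] : List Γ)).pair h₂).congr (fun _ => rfl) fun x => by simp [St, (hx x).1]
  · by_cases hi : i = 0
    · simp [St, hi, pairStr]
    · by_cases h : c a = true <;> simp [St, hi, h, pairStr]

/-- Multiplication of numbers in unary. -/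
theorem replicate_mul {U : α → List Δ} {V : α → List Θ} (hU : FP sz I U) (hV : FP sz I V) :
    FP sz I fun a => List.replicate ((U a).length * (V a).length) () := by
  let St (a : α) (i : ℕ) : List (Θ ⊕ Unit) :=
    pairStr (V a) (List.replicate (i * (V a).length) ())
  have hI := hU.length_input
  refine right (O := V) (FP.loop (St := St) hU ?_ ?_
    (hV.length_output.add (hU.length_output.mul hV.length_output)) fun a i hi => ?_)
  · exact (hV.pair (const hI ([] : List Unit))).congr (fun _ => rfl) fun a => by simp [St]
  · have hl : PolyLE (fun x : {x : α × ℕ // x.2 < (U x.1).length} => sz x.1.1)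
        fun x => (St x.1.1 x.1.2).length :=
      ((hV.length_output.add (hU.length_output.mul hV.length_output)).comp
        fun x : {x : α × ℕ // x.2 < (U x.1).length} => x.1.1).mono fun x => by
          simpa [St, pairStr] using Nat.mul_le_mul_right _ x.2.le
    have h₁ := FP.refl hl
    refine (h₁.left.pair ((h₁.left.map fun _ => ()).append h₁.right)).congr (fun _ => rfl)
      fun x => ?_
    simp only [St, List.map_const', List.replicate_append_replicate]
    rw [Nat.add_mul, one_mul, add_comm]
  · simpa [St, pairStr] using Nat.mul_le_mul_right _ hi

/-- The value of a polynomial, in unary. -/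
theorem replicate_eval (h : FP sz I O) (q : Polynomial ℕ) :
    FP sz I fun a => List.replicate (q.eval (O a).length) () := by
  induction q using Polynomial.induction_on' with
  | add p q hp hq =>
    exact (hp.append hq).congr (fun _ => rfl) fun a => by
      simp [List.replicate_append_replicate]
  | monomial n c =>
    induction n with
    | zero =>
      exact (const h.length_input (List.replicate c ())).congr (fun _ => rfl) fun a => by simp
    | succ n ih =>
      exact (replicate_mul ih h).congr (fun _ => rfl) fun a => by
        simp [pow_succ, mul_assoc]

end FP

/-- The transducer that moves the first symbol of the second component of a pair of strings to the
end of the first component, or appends `pad` to the first component if the second one is empty. -/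
def Transducer.shift {Γ : Type} (pad : List Γ) : Transducer (Γ ⊕ Γ) (Γ ⊕ Γ) where
  Q := Bool
  start := false
  step q x := if q then (true, [x]) else x.elim (fun y => (false, [Sum.inl y]))
    fun y => (true, [Sum.inl y])
  fin q := if q then [] else pad.map Sum.inl

theorem Transducer.run_shift {Γ : Type} (pad : List Γ) (s w : List Γ) :
    (Transducer.shift pad).run (pairStr s w) =
      pairStr (s ++ w.head?.elim pad fun x => [x]) w.tail := by
  have h (l : List (Γ ⊕ Γ)) : (Transducer.shift pad).runFrom true l = l := by
    induction l with
    | nil => rfl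
    | cons x l ih => exact congrArg (x :: ·) ih
  change (Transducer.shift pad).runFrom false _ = _
  induction s with
  | nil =>
    cases w with
    | nil => simp [pairStr, runFrom, Transducer.shift]
    | cons x w => exact congrArg (Sum.inl x :: ·) (h _)
  | cons x s ih => exact congrArg (Sum.inl x :: ·) ih

theorem Transducer.iterate_run_shift_nil {Γ : Type} (n : ℕ) (s w : List Γ) :
    (Transducer.shift []).run^[n] (pairStr s w) = pairStr (s ++ w.take n) (w.drop n) := by
  induction n generalizing s w with
  | zero => simp
  | succ n ih =>
    rw [iterate_succ_apply, run_shift, ih]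
    cases w <;> simp

theorem Transducer.iterate_run_shift_singleton {Γ : Type} (d : Γ) (n : ℕ) (s w : List Γ) :
    (Transducer.shift [d]).run^[n] (pairStr s w) = pairStr (s ++ w.takeD n d) (w.drop n) := by
  induction n generalizing s w with
  | zero => simp
  | succ n ih =>
    rw [iterate_succ_apply, run_shift, ih]
    cases w <;> simp

namespace FP

variable {α Γ Δ Θ : Type} [Finite Γ] [Finite Δ] [Finite Θ] {sz : α → ℕ} {I : α → List Γ}
  {U : α → List Δ} {W : α → List Θ}

theorem take (hU : FP sz I U) (hW : FP sz I W) : FP sz I fun a => (W a).take (U a).length := by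
  have hI := hU.length_input
  refine left (O' := fun a => (W a).drop (U a).length) ((FP.iterate (Transducer.shift []) hU
    ((const hI []).pair hW) hW.length_output fun a i _ => ?_).congr (fun _ => rfl) fun a => ?_)
  · rw [Transducer.iterate_run_shift_nil]; simp [pairStr]; omega
  · rw [Transducer.iterate_run_shift_nil]; simp

/-- A string can be split at a given position; the first part is padded if the string is too
short. -/
theorem takeD_pair_drop (hU : FP sz I U) (hW : FP sz I W) (d : Θ) :
    FP sz I fun a => pairStr ((W a).takeD (U a).length d) ((W a).drop (U a).length) := by
  have hI := hU.length_input
  refine (FP.iterate (Transducer.shift [d]) hU ((const hI []).pair hW)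
    (hW.length_output.add hU.length_output) fun a i hi => ?_).congr (fun _ => rfl) fun a => ?_
  · rw [Transducer.iterate_run_shift_singleton]; simp [pairStr]; omega
  · rw [Transducer.iterate_run_shift_singleton]; simp

end FP

open Computability

/-! ### Binary numbers -/

theorem encodePosNum_eq_bits (n : PosNum) : encodePosNum n = Nat.bits n := by
  induction n with
  | one => simp [encodePosNum]
  | bit0 n ih =>
    rw [encodePosNum, ih, PosNum.cast_bit0, ← two_mul, Nat.bit0_bits _ (PosNum.cast_pos n).ne']
  | bit1 n ih =>
    rw [encodePosNum, ih, PosNum.cast_bit1, ← two_mul, Nat.bit1_bits]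

theorem encodeNat_eq_bits (n : ℕ) : encodeNat n = Nat.bits n := by
  rw [encodeNat]
  conv_rhs => rw [← Num.to_of_nat n]
  cases (n : Num) with
  | zero => simp [encodeNum]
  | pos m => exact encodePosNum_eq_bits m

theorem length_encodeNat (n : ℕ) : (encodeNat n).length = n.size := by
  rw [encodeNat_eq_bits, Nat.size_eq_bits_len]

/-- The transducer that adds one to a binary number; its state is the carry. -/
def Transducer.succ : Transducer Bool Bool where
  Q := Bool
  start := true
  step q x := (q && x, [q != x])
  fin q := if q then [true] else []

theorem Transducer.run_succ (n : ℕ) :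
    Transducer.succ.run (encodeNat n) = encodeNat (n + 1) := by
  have h (l : List Bool) : Transducer.succ.runFrom false l = l := by
    induction l with
    | nil => rfl
    | cons x l ih =>
      have := congrArg (x :: ·) ih
      cases x <;> exact this
  rw [encodeNat_eq_bits, encodeNat_eq_bits]
  change Transducer.succ.runFrom true _ = _
  induction n using Nat.strong_induction_on with
  | _ n ih =>
    obtain ⟨m, rfl | rfl⟩ := Nat.even_or_odd' n
    · rcases Nat.eq_zero_or_pos m with rfl | hm
      · simp [runFrom, succ]
      · rw [Nat.bit0_bits _ hm.ne', Nat.bit1_bits]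
        exact congrArg (true :: ·) (h _)
    · rw [Nat.bit1_bits, show 2 * m + 1 + 1 = 2 * (m + 1) by ring, Nat.bit0_bits _ (by omega),
        ← ih m (by omega)]
      rfl

/-- The transducer for comparing binary numbers. It removes the first digit of each of two strings
of digits, and updates a flag that says which of the numbers formed by the digits that have been
removed so far is less. -/
def Transducer.compare : Transducer ((Bool ⊕ Bool) ⊕ Bool) ((Bool ⊕ Bool) ⊕ Bool) where
  Q := Option Bool × Option Bool
  start := (none, none)
  step
    | (none, y), Sum.inl (Sum.inl b) => ((some b, y), [])
    | (some a, y), Sum.inl (Sum.inl b) => ((some a, y), [Sum.inl (Sum.inl b)])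
    | (x, none), Sum.inl (Sum.inr b) => ((x, some b), [])
    | (x, some a), Sum.inl (Sum.inr b) => ((x, some a), [Sum.inl (Sum.inr b)])
    | (x, y), Sum.inr f => ((x, y), [Sum.inr
        (if x.getD false = y.getD false then f else y.getD false)])
  fin _ := []

theorem Transducer.run_compare (l l' : List Bool) (f : Bool) :
    Transducer.compare.run (pairStr (pairStr l l') [f]) =
      pairStr (pairStr l.tail l'.tail) [if l.head?.getD false = l'.head?.getD false then f
        else l'.head?.getD false] := by
  have h₁ (x y : Option Bool) : Transducer.compare.runFrom (x, y) [Sum.inr f] =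
      [Sum.inr (if x.getD false = y.getD false then f else y.getD false)] := by
    cases x <;> cases y <;> rfl
  have h₂ (x : Option Bool) (b : Bool) (l' : List Bool) (r : List ((Bool ⊕ Bool) ⊕ Bool)) :
      Transducer.compare.runFrom (x, some b) ((l'.map Sum.inr).map Sum.inl ++ r) =
        (l'.map Sum.inr).map Sum.inl ++ Transducer.compare.runFrom (x, some b) r := by
    induction l' with
    | nil => rfl
    | cons c l' ih => cases x <;> exact congrArg (Sum.inl (Sum.inr c) :: ·) ih
  have h₃ (b : Bool) (y : Option Bool) (l : List Bool) (r : List ((Bool ⊕ Bool) ⊕ Bool)) :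
      Transducer.compare.runFrom (some b, y) ((l.map Sum.inl).map Sum.inl ++ r) =
        (l.map Sum.inl).map Sum.inl ++ Transducer.compare.runFrom (some b, y) r := by
    induction l with
    | nil => rfl
    | cons c l ih => cases y <;> exact congrArg (Sum.inl (Sum.inl c) :: ·) ih
  have h₄ (x : Option Bool) (l' : List Bool) :
      Transducer.compare.runFrom (x, none) ((l'.map Sum.inr).map Sum.inl ++ [Sum.inr f]) =
        (l'.tail.map Sum.inr).map Sum.inl ++ [Sum.inr
          (if x.getD false = l'.head?.getD false then f else l'.head?.getD false)] := by
    cases l' with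
    | nil => exact h₁ x none
    | cons c l' =>
      refine Eq.trans ?_ ((h₂ x c l' [Sum.inr f]).trans ?_)
      · cases x <;> rfl
      · rw [h₁]; rfl
  simp only [pairStr, List.map_append, List.append_assoc, List.map_cons, List.map_nil]
  cases l with
  | nil => exact h₄ none l'
  | cons b l =>
    refine Eq.trans ?_ ((h₃ b none l
      ((l'.map Sum.inr).map Sum.inl ++ [Sum.inr f])).trans ?_)
    · rfl
    · rw [h₄]; rfl

theorem head?_drop_encodeNat (n i : ℕ) :
    ((encodeNat n).drop i).head?.getD false = n.testBit i := by
  rw [encodeNat_eq_bits, Nat.testBit_eq_inth, List.getI_eq_getElem?_getD, List.head?_drop]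
  rfl

theorem decide_mod_two_pow_succ_lt (m n i : ℕ) :
    decide (m % 2 ^ (i + 1) < n % 2 ^ (i + 1)) =
      if m.testBit i = n.testBit i then decide (m % 2 ^ i < n % 2 ^ i) else n.testBit i := by
  have hm := Nat.mod_lt m (Nat.two_pow_pos i)
  have hn := Nat.mod_lt n (Nat.two_pow_pos i)
  rw [Nat.mod_pow_succ, Nat.mod_pow_succ, Nat.testBit_eq_decide_div_mod_eq,
    Nat.testBit_eq_decide_div_mod_eq]
  rcases Nat.mod_two_eq_zero_or_one (m / 2 ^ i) with h | h <;>
    rcases Nat.mod_two_eq_zero_or_one (n / 2 ^ i) with h' | h' <;>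
    simp [h, h'] <;> omega

namespace FP

variable {α Γ Δ : Type} [Finite Γ] [Finite Δ] {sz : α → ℕ} {I : α → List Γ}

/-- Addition of a number in binary and a number in unary. -/
theorem encodeNat_add {U : α → List Δ} {m : α → ℕ} (hU : FP sz I U)
    (hm : FP sz I fun a => encodeNat (m a)) :
    FP sz I fun a => encodeNat (m a + (U a).length) := by
  have hrun (a : α) (i : ℕ) :
      Transducer.succ.run^[i] (encodeNat (m a)) = encodeNat (m a + i) := by
    induction i with
    | zero => rfl
    | succ i ih => rw [iterate_succ_apply', ih, Transducer.run_succ]; rfl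
  refine (FP.iterate Transducer.succ hU hm (hm.length_output.add hU.length_output)
    fun a i hi => ?_).congr (fun _ => rfl) fun a => hrun a _
  rw [hrun]
  refine le_trans ?_ (Nat.add_le_add_left hi _)
  clear hi
  induction i with
  | zero => rfl
  | succ i ih =>
    refine le_trans ?_ (Nat.succ_le_succ ih)
    rw [length_encodeNat, length_encodeNat]
    refine Nat.size_le.2 ?_
    have := Nat.lt_size_self (m a + i)
    rw [pow_succ]
    omega

/-- Comparison of numbers in binary. -/
theorem decide_lt {m n : α → ℕ} (hm : FP sz I fun a => encodeNat (m a))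
    (hn : FP sz I fun a => encodeNat (n a)) : FP sz I fun a => [decide (m a < n a)] := by
  have hI := hm.length_input
  have hrun (a : α) (i : ℕ) :
      Transducer.compare.run^[i] (pairStr (pairStr (encodeNat (m a)) (encodeNat (n a))) [false]) =
        pairStr (pairStr ((encodeNat (m a)).drop i) ((encodeNat (n a)).drop i))
          [decide (m a % 2 ^ i < n a % 2 ^ i)] := by
    induction i with
    | zero => simp [Nat.mod_one]
    | succ i ih =>
      rw [iterate_succ_apply', ih, Transducer.run_compare, head?_drop_encodeNat,
        head?_drop_encodeNat, decide_mod_two_pow_succ_lt, List.tail_drop, List.tail_drop]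
  refine right (O := fun _ => ([] : List (Bool ⊕ Bool)))
    ((FP.iterate Transducer.compare (hm.append hn) ((hm.pair hn).pair (const hI [false]))
    ((hm.length_output.add hn.length_output).add (.const _ 1)) fun a i hi => ?_).congr
    (fun _ => rfl) fun a => ?_)
  · rw [hrun]; simp [pairStr]; omega
  · have hlt (k l : ℕ) : k < 2 ^ (k.size + l) :=
      (Nat.lt_size_self k).trans_le (Nat.pow_le_pow_right (by norm_num) (by omega))
    rw [hrun, List.drop_eq_nil_of_le (by simp), List.drop_eq_nil_of_le (by simp),
      List.length_append, length_encodeNat, length_encodeNat, Nat.mod_eq_of_lt (hlt _ _),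
      Nat.mod_eq_of_lt (by rw [add_comm]; exact hlt _ _)]
    rfl

end FP

/-! ### Encodings of graphs -/

section encodings

open Classical in
/-- A row of the adjacency matrix. -/
noncomputable def rowStr (G : FinGraph) (i : G.V) : List (Option Bool) :=
  (List.finRange G.order).map fun j => some (decide (G.graph.Adj i j))

theorem encodeGraph_eq (G : FinGraph) :
    encodeGraph G = (List.finRange G.order).flatMap fun i => rowStr G i ++ [none] := rfl

theorem length_encodeGraph (G : FinGraph) :
    (encodeGraph G).length = G.order * (G.order + 1) := by
  simp [encodeGraph_eq, rowStr, List.length_flatMap]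

theorem exists_encodeGraph_eq_append (G : FinGraph) : ∃ l, encodeGraph G = l ++ [none] := by
  obtain ⟨n, hn⟩ := Nat.exists_eq_succ_of_ne_zero G.order_pos.ne'
  rw [encodeGraph_eq]
  have : List.finRange G.order ≠ [] := by simp [hn]
  rw [← List.dropLast_append_getLast this, List.flatMap_append]
  rw [List.flatMap_singleton, ← List.append_assoc]
  exact ⟨_, rfl⟩

/-- The separators in the adjacency matrix represent the order of the graph in unary. -/
theorem filter_encodeGraph (G : FinGraph) :
    ((encodeGraph G).filter Option.isNone).length = G.order := by
  have (i : G.V) : (rowStr G i).filter Option.isNone = [] := by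
    simp [rowStr, List.filter_map, Function.comp_def]
  simp [encodeGraph_eq, List.filter_flatMap, List.length_flatMap, this]

theorem rdropWhile_append_some {l : List (Option Bool)} (hl : ∃ l', l = l' ++ [none])
    (b : List Bool) : (l ++ b.map some).rdropWhile Option.isSome = l := by
  obtain ⟨l', rfl⟩ := hl
  rw [List.rdropWhile, List.reverse_append, ← List.map_reverse,
    List.dropWhile_append_of_pos (by simp; grind)]
  simp

theorem rtakeWhile_append_some {l : List (Option Bool)} (hl : ∃ l', l = l' ++ [none])
    (b : List Bool) : (l ++ b.map some).rtakeWhile Option.isSome = b.map some := by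
  obtain ⟨l', rfl⟩ := hl
  rw [List.rtakeWhile, List.reverse_append, ← List.map_reverse,
    List.takeWhile_append_of_pos (by simp; grind)]
  simp

end encodings

namespace FP

variable {α Γ Δ : Type} [Finite Γ] [Finite Δ] {sz : α → ℕ} {I : α → List Γ}
  {x : α → FinGraph × ℤ}

theorem encodeGraph (h : FP sz I fun a => encodeGraphInt (x a)) :
    FP sz I fun a => encodeGraph (x a).1 :=
  (h.rdropWhile Option.isSome).congr (fun _ => rfl) fun _ =>
    rdropWhile_append_some (exists_encodeGraph_eq_append _) _

theorem encodeInt (h : FP sz I fun a => encodeGraphInt (x a)) :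
    FP sz I fun a => encodeInt (x a).2 :=
  ((h.rtakeWhile Option.isSome).filterMap id).congr (fun _ => rfl) fun a => by
    rw [encodeGraphInt, rtakeWhile_append_some (exists_encodeGraph_eq_append _)]
    simp [List.filterMap_map]

end FP

/-! ### The throttling problem is in NP -/

/-- A minimum of natural numbers, which is `⊤` over the empty set, is a natural number less than `k`
if and only if one of the numbers is less than `k`. -/
theorem exists_iInf_eq_lt_iff {β : Type} (A : Set β) (f : β → ℕ) (k : ℤ) :
    (∃ m : ℕ, (⨅ S ∈ A, (f S : ℕ∞)) = m ∧ (m : ℤ) < k) ↔ ∃ S ∈ A, (f S : ℤ) < k := by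
  constructor
  · rintro ⟨m, hm, hk⟩
    by_contra! h
    have : ((m + 1 : ℕ) : ℕ∞) ≤ m := by
      rw [← hm]
      refine le_iInf₂ fun S hS => ?_
      have := h S hS
      exact_mod_cast (by omega : m + 1 ≤ f S)
    have : m + 1 ≤ m := by exact_mod_cast this
    omega
  · rintro ⟨S, hS, hk⟩
    have hle : (⨅ S ∈ A, (f S : ℕ∞)) ≤ f S := iInf₂_le S hS
    obtain ⟨m, hm⟩ := ENat.ne_top_iff_exists.1 (ne_top_of_le_ne_top (ENat.natCast_ne_top _) hle)
    refine ⟨m, hm.symm, ?_⟩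
    rw [← hm] at hle
    have : m ≤ f S := by exact_mod_cast hle
    omega

section

variable {X : (G : FinGraph) → Set (Finset G.V)} {p : (G : FinGraph) → Finset G.V → ℕ}
  {I : FinGraph × ℤ}

theorem mem_MinimumXSet : I ∈ MinimumXSet X ↔ ∃ S ∈ X I.1, (S.card : ℤ) < I.2 :=
  exists_iInf_eq_lt_iff _ _ _

theorem mem_XPThrottling :
    I ∈ XPThrottling X p ↔ ∃ S ∈ X I.1, ((S.card + p I.1 S : ℕ) : ℤ) < I.2 :=
  exists_iInf_eq_lt_iff _ _ _

end

theorem takeD_eq_map_finRange {β : Type} (n : ℕ) (w : List β) (d : β) :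
    w.takeD n d = (List.finRange n).map fun i : Fin n => w.getD i d := by
  induction n generalizing w with
  | zero => simp
  | succ n ih =>
    rw [List.takeD_succ, List.finRange_succ, ih]
    cases w <;> simp [Function.comp_def]

/-- The set of those indices at which the string `w` has the symbol `true`. -/
def setOfStr (n : ℕ) (w : List Bool) : Finset (Fin n) :=
  Finset.univ.filter fun i => w.getD i false = true

theorem encodeSet_setOfStr (n : ℕ) (w : List Bool) :
    encodeSet (setOfStr n w) = (w.takeD n false).map some := by
  simp [encodeSet, setOfStr, takeD_eq_map_finRange, Function.comp_def]

theorem exists_setOfStr {n : ℕ} (S : Finset (Fin n)) :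
    ∃ w : List Bool, w.length = n ∧ ∀ w', setOfStr n (w ++ w') = S := by
  refine ⟨(List.finRange n).map fun i => decide (i ∈ S), by simp, fun w' => ?_⟩
  ext i
  simp [setOfStr, List.getD, List.getElem?_append]

theorem length_filter_encodeSet {n : ℕ} (S : Finset (Fin n)) :
    ((encodeSet S).filter fun b => decide (b = some true)).length = S.card := by
  rw [encodeSet, List.filter_map, List.length_map,
    ← List.toFinset_card_of_nodup ((List.nodup_finRange n).filter _)]
  congr 1
  ext i
  simp

/-- The transducer that turns the encoding of an integer into that of its nonnegative part. -/
def Transducer.toNat : Transducer Bool Bool where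
  Q := Option Bool
  start := none
  step
    | none, b => (some b, [])
    | some true, _ => (some true, [])
    | some false, b => (some false, [b])
  fin _ := []

theorem Transducer.run_toNat (k : ℤ) : Transducer.toNat.run (encodeInt k) = encodeNat k.toNat := by
  have h₁ (l : List Bool) : Transducer.toNat.runFrom (some true) l = [] := by
    induction l with
    | nil => rfl
    | cons x l ih => exact ih
  have h₂ (l : List Bool) : Transducer.toNat.runFrom (some false) l = l := by
    induction l with
    | nil => rfl
    | cons x l ih => exact congrArg (x :: ·) ih
  have : Transducer.toNat.run (encodeInt k) =
    Transducer.toNat.runFrom (some (decide (k < 0))) (encodeNat k.natAbs) := rfl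
  rw [this]
  by_cases hk : k < 0
  · simp only [hk, decide_true]
    rw [h₁, Int.toNat_of_nonpos hk.le]
    rfl
  · simp only [hk, decide_false]
    rw [h₂]
    congr 1
    omega

/-- The throttling problem is in NP: a witness consists of the set `S` and a witness for
`S ∈ X G`. -/
theorem inNP_XPThrottling {X : (G : FinGraph) → Set (Finset G.V)}
    {p : (G : FinGraph) → Finset G.V → ℕ}
    (hX : InNP encodeGraphSet {I : (G : FinGraph) × Finset G.V | I.2 ∈ X I.1})
    (hp : PolyTime
      (fun I : {I : (G : FinGraph) × Finset G.V // I.2 ∈ X I.1} => encodeGraphSet I.1)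
      encodeNat (fun I => p I.1.1 I.1.2)) :
    InNP encodeGraphInt (XPThrottling X p) := by
  obtain ⟨v, q, hv, hq⟩ := hX
  -- the set and the witness for membership in `X G` that are read off from a witness
  let S (a : (FinGraph × ℤ) × List Bool) : Finset a.1.1.V := setOfStr a.1.1.order a.2
  let J (a : (FinGraph × ℤ) × List Bool) : (G : FinGraph) × Finset G.V := ⟨a.1.1, S a⟩
  -- a witness is valid only if it is short: this has to be enforced, as `p` can be computed
  -- only for members of `X G`
  let w (a : (FinGraph × ℤ) × List Bool) : List Bool :=
    (a.2.drop a.1.1.order).take (q.eval (encodeGraphSet (J a)).length)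
  let c (a : (FinGraph × ℤ) × List Bool) : Bool := v (J a, w a)
  have hc (a) (h : c a = true) : (J a).2 ∈ X (J a).1 :=
    (hq (J a)).2 ⟨w a, by simp [w], h⟩
  let r (a : {a // c a = true}) : Bool :=
    decide ((S a.1).card + p a.1.1.1 (S a.1) < a.1.1.2.toNat)
  refine ⟨fun a => if h : c a = true then r ⟨a, h⟩ else false,
    Polynomial.X + q.comp (2 * Polynomial.X), ?_, fun I => ?_⟩
  · refine FP.polyTime ?_
    let sz (a : (FinGraph × ℤ) × List Bool) : ℕ := (encodeWithWitness encodeGraphInt a).length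
    let E := encodeWithWitness encodeGraphInt
    have h₀ : FP sz E fun a => pairStr (encodeGraphInt a.1) a.2 := FP.refl (PolyLE.self sz)
    have hG := h₀.left.encodeGraph
    have hN := hG.filter Option.isNone
    have hS : FP sz E fun a => encodeSet (S a) :=
      ((FP.takeD_pair_drop hN h₀.right false).left.map some).congr (fun _ => rfl) fun a => by
        rw [filter_encodeGraph, encodeSet_setOfStr]
    have hJ : FP sz E fun a => encodeGraphSet (J a) := hG.append hS
    have hw : FP sz E w :=
      (FP.take (hJ.replicate_eval q) (FP.takeD_pair_drop hN h₀.right false).right).congr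
        (fun _ => rfl) fun a => by
          rw [filter_encodeGraph, List.length_replicate]
    have hcE : FP sz E fun a => [c a] := (hJ.pair hw).trans
      (hv.fp (sz := sz) (fun a => (J a, w a)) (hJ.pair hw).length_output)
    have hk : FP sz E fun a => encodeNat a.1.2.toNat :=
      (h₀.left.encodeInt.run Transducer.toNat).congr (fun _ => rfl) fun a => Transducer.run_toNat _
    refine FP.guard hcE ?_
    have hJ' := hJ.comp (fun a : {a // c a = true} => a.1)
    have hp' := hJ'.trans (hp.fp (sz := fun a : {a // c a = true} => sz a)
      (fun a => ⟨J a.1, hc a.1 a.2⟩) hJ'.length_output)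
    have hcard := (hS.filter fun b => decide (b = some true)).comp fun a : {a // c a = true} => a.1
    have hsum := FP.encodeNat_add hcard hp'
    refine (FP.decide_lt hsum (hk.comp fun a : {a // c a = true} => a.1)).congr (fun _ => rfl)
      fun a => ?_
    simp only [r, length_filter_encodeSet, J]
    rw [add_comm]
  · rw [mem_XPThrottling]
    have hiff (x : List Bool) :
        (if h : c (I, x) = true then r ⟨(I, x), h⟩ else false) = true ↔
          c (I, x) = true ∧ (S (I, x)).card + p I.1 (S (I, x)) < I.2.toNat := by
      by_cases h : c (I, x) = true <;> simp [h, r]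
    constructor
    · rintro ⟨T, hT, hk⟩
      obtain ⟨u, hu, hu'⟩ := (hq ⟨I.1, T⟩).1 hT
      obtain ⟨x, hx, hxT⟩ := exists_setOfStr T
      refine ⟨x ++ u, ?_, (hiff _).2 ?_⟩
      · have h₁ := length_encodeGraph I.1
        have h₂ : (encodeGraphSet ⟨I.1, T⟩).length =
            I.1.order * (I.1.order + 1) + I.1.order := by
          rw [← h₁, encodeGraphSet, List.length_append, encodeSet]; simp
        have h₃ : (encodeGraphInt I).length = I.1.order * (I.1.order + 1) +
            (encodeInt I.2).length := by
          rw [← h₁, encodeGraphInt, List.length_append, List.length_map]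
        have h₄ : I.1.order ≤ I.1.order * (I.1.order + 1) :=
          Nat.le_mul_of_pos_right _ (Nat.succ_pos _)
        have h₅ : q.eval (encodeGraphSet ⟨I.1, T⟩).length ≤
            q.eval (2 * (encodeGraphInt I).length) := eval_mono q (by omega)
        simp only [List.length_append, Polynomial.eval_add, Polynomial.eval_X,
          Polynomial.eval_comp, Polynomial.eval_mul, Polynomial.eval_ofNat]
        omega
      · have hST : S (I, x ++ u) = T := hxT u
        have hw : w (I, x ++ u) = u := by
          simp only [w, J, hST]
          rw [List.drop_left' hx, List.take_of_length_le hu]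
        refine ⟨?_, ?_⟩
        · simp only [c, J, hST, hw]
          exact hu'
        · rw [hST]
          omega
    · rintro ⟨x, -, hx⟩
      obtain ⟨hcx, hlt⟩ := (hiff x).1 hx
      exact ⟨S (I, x), hc _ hcx, by omega⟩

/-! ### Logarithms in unary -/

/-- The transducer that replaces the first `true` by `false`, and erases every second one of the
others, starting with the third one of all. It leaves `t / 2` of `t` symbols `true`. -/
def Transducer.halve : Transducer Bool Bool where
  Q := Option Bool
  start := none
  step
    | q, false => (q, [false])
    | none, true => (some true, [false])
    | some true, true => (some false, [true])
    | some false, true => (some true, [])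
  fin _ := []

/-- The `false`s at the beginning count the applications of the transducer to a nonempty string of
`true`s; the length of the latter is halved each time. -/
theorem Transducer.run_halve (f t : ℕ) :
    Transducer.halve.run (List.replicate f false ++ List.replicate t true) =
      if t = 0 then List.replicate f false else
        List.replicate (f + 1) false ++ List.replicate (t / 2) true := by
  have h₁ (t : ℕ) : Transducer.halve.runFrom (some true) (List.replicate t true) =
      List.replicate ((t + 1) / 2) true := by
    induction t using Nat.strong_induction_on with
    | _ t ih =>
      match t with
      | 0 => rfl
      | 1 => rfl
      | t + 2 =>
        rw [show (t + 2 + 1) / 2 = (t + 1) / 2 + 1 by omega, List.replicate_succ]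
        exact congrArg (true :: ·) (ih t (by omega))
  have h₂ (l : List Bool) : Transducer.halve.runFrom none (List.replicate f false ++ l) =
      List.replicate f false ++ Transducer.halve.runFrom none l := by
    induction f with
    | zero => rfl
    | succ f ih => exact congrArg (false :: ·) ih
  refine (h₂ _).trans ?_
  cases t with
  | zero => simp [runFrom, Transducer.halve]
  | succ t =>
    rw [if_neg (Nat.succ_ne_zero t)]
    refine (congrArg (fun l => List.replicate f false ++ (false :: l)) (h₁ t)).trans ?_
    simp [List.replicate_succ', -List.replicate_append_replicate]

theorem size_eq_succ {t : ℕ} (ht : t ≠ 0) : t.size = (t / 2).size + 1 := by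
  have h := Nat.bit_bodd_div2 t
  rw [← h, Nat.size_bit (by rwa [h]), h, Nat.div2_val]

theorem Transducer.iterate_run_halve (n t f : ℕ) (hn : t ≤ n) :
    Transducer.halve.run^[n] (List.replicate f false ++ List.replicate t true) =
      List.replicate (f + t.size) false := by
  induction n generalizing t f with
  | zero =>
    obtain rfl : t = 0 := by omega
    simp
  | succ n ih =>
    rw [iterate_succ_apply, run_halve]
    split_ifs with h
    · subst h
      simpa using ih 0 f (Nat.zero_le _)
    · rw [ih _ _ (by omega), size_eq_succ h]
      congr 1
      omega

theorem Transducer.length_run_halve_le (l : List Bool) :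
    (Transducer.halve.run l).length ≤ l.length := by
  have (q : Option Bool) : (Transducer.halve.runFrom q l).length ≤ l.length := by
    induction l generalizing q with
    | nil => exact le_rfl
    | cons x l ih =>
      have h : (Transducer.halve.step q x).2.length ≤ 1 := by
        cases x <;> rcases q with _ | _ | _ <;> simp [Transducer.halve]
      have e : Transducer.halve.runFrom q (x :: l) = (Transducer.halve.step q x).2 ++
        Transducer.halve.runFrom (Transducer.halve.step q x).1 l := rfl
      rw [e, List.length_append, List.length_cons]
      have := ih (Transducer.halve.step q x).1
      omega
  exact this _

/-- The number of binary digits of a number, where both numbers are in unary. -/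
theorem FP.replicate_size {α Γ Δ : Type} [Finite Γ] [Finite Δ] {sz : α → ℕ} {I : α → List Γ}
    {U : α → List Δ} (hU : FP sz I U) :
    FP sz I fun a => List.replicate (U a).length.size false := by
  refine (FP.iterate Transducer.halve hU (hU.map fun _ => true) hU.length_output
    fun a i _ => ?_).congr (fun _ => rfl) fun a => ?_
  · induction i with
    | zero => simp
    | succ i ih =>
      rw [iterate_succ_apply']
      exact (Transducer.length_run_halve_le _).trans (ih (by omega))
  · simpa using Transducer.iterate_run_halve (U a).length (U a).length 0 le_rfl

/-! ### Disjoint unions of graphs -/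

/-- Insert the string `u` before, and the string `v` after each separator. -/
def insertNone (u v l : List (Option Bool)) : List (Option Bool) :=
  l.flatMap fun x => x.elim (u ++ none :: v) fun b => [some b]

theorem insertNone_append (u v l l' : List (Option Bool)) :
    insertNone u v (l ++ l') = insertNone u v l ++ insertNone u v l' :=
  List.flatMap_append

theorem insertNone_map_some (u v : List (Option Bool)) (b : List Bool) :
    insertNone u v (b.map some) = b.map some := by
  induction b with
  | nil => rfl
  | cons x b ih => exact congrArg (some x :: ·) ih

theorem insertNone_singleton (u v : List (Option Bool)) :
    insertNone u v [none] = u ++ none :: v := by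
  simp [insertNone]

theorem insertNone_insertNone (b c d e : List Bool) (l : List (Option Bool)) :
    insertNone (b.map some) (c.map some) (insertNone (d.map some) (e.map some) l) =
      insertNone ((d ++ b).map some) ((c ++ e).map some) l := by
  induction l with
  | nil => rfl
  | cons x l ih =>
    have h (u v : List (Option Bool)) :
      insertNone u v (x :: l) = insertNone u v [x] ++ insertNone u v l :=
        insertNone_append u v [x] l
    rw [h, h, insertNone_append, ih]
    cases x with
    | none =>
      rw [insertNone_singleton, insertNone_singleton, insertNone_append, ← List.singleton_append,
        insertNone_append, insertNone_map_some, insertNone_map_some, insertNone_singleton]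
      simp
    | some b => rfl

theorem length_insertNone_le (u v l : List (Option Bool)) :
    (insertNone u v l).length ≤ l.length * (u.length + v.length + 1) := by
  induction l with
  | nil => simp [insertNone]
  | cons x l ih =>
    have h : insertNone u v (x :: l) = insertNone u v [x] ++ insertNone u v l :=
      insertNone_append u v [x] l
    rw [h, List.length_append, List.length_cons, Nat.add_mul, one_mul, add_comm]
    refine add_le_add ih ?_
    cases x <;> simp [insertNone]
    omega

/-- Insertion of strings of zeros before and after separators. -/
theorem FP.insertNone {α Γ Δ : Type} [Finite Γ] [Finite Δ] {sz : α → ℕ} {I : α → List Γ}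
    {U : α → List Δ} {L : α → List (Option Bool)} (hU : FP sz I U) (hL : FP sz I L) (b c : ℕ) :
    FP sz I fun a => insertNone ((List.replicate ((U a).length * b) false).map some)
      ((List.replicate ((U a).length * c) false).map some) (L a) := by
  let St (a : α) (i : ℕ) : List (Option Bool) :=
    Throttling.insertNone ((List.replicate (i * b) false).map some)
      ((List.replicate (i * c) false).map some) (L a)
  have hB : PolyLE sz fun a => (L a).length * ((U a).length * b + (U a).length * c + 1) :=
    hL.length_output.mul (((hU.length_output.mul (.const _ b)).add
      (hU.length_output.mul (.const _ c))).add (.const _ 1))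
  have hSt (a : α) (i : ℕ) (hi : i ≤ (U a).length) :
      (St a i).length ≤ (L a).length * ((U a).length * b + (U a).length * c + 1) := by
    refine (length_insertNone_le _ _ _).trans ?_
    simp only [List.length_map, List.length_replicate]
    gcongr
  refine FP.loop (St := St) hU (hL.congr (fun _ => rfl) fun a => ?_) ?_ hB hSt
  · have (l : List (Option Bool)) : Throttling.insertNone [] [] l = l := by
      induction l with
      | nil => rfl
      | cons x l ih => cases x <;> exact congrArg (_ :: ·) ih
    simp [St, this]
  · have hl : PolyLE (fun x : {x : α × ℕ // x.2 < (U x.1).length} => sz x.1.1)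
        fun x => (St x.1.1 x.1.2).length :=
      (hB.comp fun x : {x : α × ℕ // x.2 < (U x.1).length} => x.1.1).mono
        fun x => hSt _ _ x.2.le
    refine ((FP.refl hl).flatMap fun x => x.elim ((List.replicate b false).map some ++
      none :: (List.replicate c false).map some) fun b => [some b]).congr (fun _ => rfl) fun x => ?_
    refine (insertNone_insertNone _ _ _ _ _).trans ?_
    simp only [St, List.replicate_append_replicate, Nat.add_mul, one_mul]
    rw [add_comm c]

theorem finRange_add (n m : ℕ) : List.finRange (n + m) =
    (List.finRange n).map (Fin.castAdd m) ++ (List.finRange m).map (Fin.natAdd n) := by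
  have h (k : ℕ) : List.finRange k = List.ofFn fun i => i := (List.ofFn_id k).symm
  rw [h, List.ofFn_add, h, h, List.map_ofFn, List.map_ofFn]
  rfl

theorem map_finRange_add {β : Type*} (n m : ℕ) (f : Fin (n + m) → β) :
    (List.finRange (n + m)).map f = ((List.finRange n).map fun i => f (Fin.castAdd m i)) ++
      (List.finRange m).map fun i => f (Fin.natAdd n i) := by
  rw [finRange_add, List.map_append, List.map_map, List.map_map]
  rfl

section

variable (G H : FinGraph)

theorem disjUnion_adj (x y : G.V ⊕ H.V) :
    (G.disjUnion H).graph.Adj (finSumFinEquiv x) (finSumFinEquiv y) ↔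
      (G.graph ⊕g H.graph).Adj x y :=
  SimpleGraph.map_adj_apply (f := finSumFinEquiv.toEmbedding)

theorem rowStr_disjUnion_castAdd (i : G.V) :
    rowStr (G.disjUnion H) (Fin.castAdd H.order i) =
      rowStr G i ++ (List.replicate H.order false).map some := by
  have h₁ (j : G.V) : (G.disjUnion H).graph.Adj (Fin.castAdd H.order i) (Fin.castAdd H.order j) ↔
      G.graph.Adj i j := (disjUnion_adj G H (Sum.inl i) (Sum.inl j)).trans (by simp)
  have h₂ (j : H.V) : ¬ (G.disjUnion H).graph.Adj (Fin.castAdd H.order i) (Fin.natAdd G.order j) :=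
    fun h => by simpa using (disjUnion_adj G H (Sum.inl i) (Sum.inr j)).1 h
  refine (map_finRange_add G.order H.order _).trans (congrArg₂ (· ++ ·) ?_ ?_)
  · exact congrArg (List.map · _) (funext fun j => congrArg some (decide_eq_decide.2 (h₁ j)))
  · simp [h₂]

theorem rowStr_disjUnion_natAdd (i : H.V) :
    rowStr (G.disjUnion H) (Fin.natAdd G.order i) =
      (List.replicate G.order false).map some ++ rowStr H i := by
  have h₁ (j : H.V) : (G.disjUnion H).graph.Adj (Fin.natAdd G.order i) (Fin.natAdd G.order j) ↔
      H.graph.Adj i j := (disjUnion_adj G H (Sum.inr i) (Sum.inr j)).trans (by simp)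
  have h₂ (j : G.V) : ¬ (G.disjUnion H).graph.Adj (Fin.natAdd G.order i) (Fin.castAdd H.order j) :=
    fun h => by simpa using (disjUnion_adj G H (Sum.inr i) (Sum.inl j)).1 h
  refine (map_finRange_add G.order H.order _).trans (congrArg₂ (· ++ ·) ?_ ?_)
  · simp [h₂]
  · exact congrArg (List.map · _) (funext fun j => congrArg some (decide_eq_decide.2 (h₁ j)))

theorem exists_rowStr_eq_map (i : G.V) : ∃ b : List Bool, rowStr G i = b.map some := by
  classical
  exact ⟨(List.finRange G.order).map fun j => decide (G.graph.Adj i j), by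
    simp [rowStr, Function.comp_def]⟩

/-- The adjacency matrix of a disjoint union is block diagonal: zeros have to be added at the end of
each row of the first matrix, and at the beginning of each row of the second one. In the latter
case, zeros are inserted in front of the matrix and after each row, and those after the last row
are removed. -/
theorem encodeGraph_disjUnion : encodeGraph (G.disjUnion H) =
    insertNone ((List.replicate H.order false).map some) [] (encodeGraph G) ++
      ((List.replicate G.order false).map some ++
        insertNone [] ((List.replicate G.order false).map some) (encodeGraph H)).rdropWhile
          Option.isSome := by
  have h₁ (u : List (Option Bool)) (l : List G.V) :
      insertNone u [] (l.flatMap fun i => rowStr G i ++ [none]) =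
        l.flatMap fun i => (rowStr G i ++ u) ++ [none] := by
    induction l with
    | nil => rfl
    | cons i l ih =>
      obtain ⟨b, hb⟩ := exists_rowStr_eq_map G i
      rw [List.flatMap_cons, insertNone_append, ih, insertNone_append, insertNone_singleton, hb,
        insertNone_map_some]
      simp [hb]
  have h₂ (u : List (Option Bool)) (l : List H.V) :
      u ++ insertNone [] u (l.flatMap fun i => rowStr H i ++ [none]) =
        (l.flatMap fun i => (u ++ rowStr H i) ++ [none]) ++ u := by
    induction l with
    | nil => simp [insertNone]
    | cons i l ih =>
      obtain ⟨b, hb⟩ := exists_rowStr_eq_map H i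
      rw [List.flatMap_cons, insertNone_append, insertNone_append, insertNone_singleton, hb,
        insertNone_map_some, List.flatMap_cons, List.append_assoc _ _ u, ← ih]
      simp [hb]
  have h₃ : ∃ l', ((List.finRange H.order).flatMap fun i =>
      ((List.replicate G.order false).map some ++ rowStr H i) ++ [none]) = l' ++ [none] := by
    obtain ⟨n, hn⟩ := Nat.exists_eq_succ_of_ne_zero H.order_pos.ne'
    have : List.finRange H.order ≠ [] := by simp [hn]
    rw [← List.dropLast_append_getLast this, List.flatMap_append, List.flatMap_singleton,
      ← List.append_assoc]
    exact ⟨_, rfl⟩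
  rw [encodeGraph_eq G, h₁, encodeGraph_eq H, h₂, rdropWhile_append_some h₃, encodeGraph_eq]
  refine (congrArg List.flatten (map_finRange_add G.order H.order _)).trans
    (List.flatten_append.trans (congrArg₂ (· ++ ·) ?_ ?_))
  · exact congrArg (fun f => List.flatten (List.map f _)) (funext fun i =>
      congrArg (· ++ [none]) (rowStr_disjUnion_castAdd G H i))
  · exact congrArg (fun f => List.flatten (List.map f _)) (funext fun i =>
      congrArg (· ++ [none]) (rowStr_disjUnion_natAdd G H i))

end

/-- The transducer that doubles an integer; the digit `0` is inserted after the sign, unless there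
are no further digits. -/
def Transducer.double : Transducer Bool Bool where
  Q := Option Bool
  start := none
  step
    | none, b => (some false, [b])
    | some false, b => (some true, [false, b])
    | some true, b => (some true, [b])
  fin _ := []

theorem Transducer.run_double (k : ℤ) :
    Transducer.double.run (encodeInt k) = encodeInt (2 * k) := by
  have h₁ (l : List Bool) : Transducer.double.runFrom (some true) l = l := by
    induction l with
    | nil => rfl
    | cons x l ih => exact congrArg (x :: ·) ih
  have h₂ (n : ℕ) : Transducer.double.runFrom (some false) (encodeNat n) = encodeNat (2 * n) := by
    rw [encodeNat_eq_bits, encodeNat_eq_bits]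
    rcases Nat.eq_zero_or_pos n with rfl | hn
    · simp [runFrom, Transducer.double]
    · rw [Nat.bit0_bits _ hn.ne']
      have hb : n.bits ≠ [] := fun h => by
        have := Nat.size_eq_bits_len n
        rw [h, List.length_nil, eq_comm, Nat.size_eq_zero] at this
        omega
      cases h : n.bits with
      | nil => exact absurd h hb
      | cons x l => exact congrArg (fun l => false :: x :: l) (h₁ l)
  refine (congrArg (decide (k < 0) :: ·) (h₂ k.natAbs)).trans ?_
  rw [encodeInt, Int.natAbs_mul]
  congr 2
  exact propext (by omega)

/-! ### The reduction -/

/-- Two disjoint copies of the graph, and twice the number. -/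
def double (I : FinGraph × ℤ) : FinGraph × ℤ := (I.1.disjUnion I.1, 2 * I.2)

theorem iterate_double_order (i : ℕ) (I : FinGraph × ℤ) :
    (double^[i] I).1.order = 2 ^ i * I.1.order := by
  induction i with
  | zero => simp
  | succ i ih =>
    rw [iterate_succ_apply']
    change (double^[i] I).1.order + (double^[i] I).1.order = _
    rw [ih]; ring

theorem iterate_double_snd (i : ℕ) (I : FinGraph × ℤ) :
    (double^[i] I).2 = 2 ^ i * I.2 := by
  induction i with
  | zero => simp
  | succ i ih =>
    rw [iterate_succ_apply']
    change 2 * (double^[i] I).2 = _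
    rw [ih]; ring

theorem FP.double {α Γ : Type} [Finite Γ] {sz : α → ℕ} {I : α → List Γ} {x : α → FinGraph × ℤ}
    (h : FP sz I fun a => encodeGraphInt (x a)) :
    FP sz I fun a => encodeGraphInt (double (x a)) := by
  have hG := h.encodeGraph
  have hN := hG.filter Option.isNone
  have h₁ := hN.insertNone hG 1 0
  have h₂ := ((hN.map fun _ => some false).append (hN.insertNone hG 0 1)).rdropWhile Option.isSome
  have h₃ := (h.encodeInt.run Transducer.double).map some
  refine ((h₁.append h₂).append h₃).congr (fun _ => rfl) fun a => ?_
  simp only [filter_encodeGraph, List.map_const', mul_one, mul_zero, List.replicate_zero,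
    List.map_nil, Transducer.run_double]
  rw [encodeGraphInt, Throttling.double, encodeGraph_disjUnion, List.map_replicate]

/-- The number of doublings in the reduction is chosen such that the number of copies of the graph
is at least `C * n ^ c`, where `n` is the order of the graph, and is polynomially bounded. -/
def reduction (c C : ℕ) (I : FinGraph × ℤ) : FinGraph × ℤ :=
  double^[I.1.order.size * c + C] I

/-- The number of copies in the reduction exceeds all values of `p`. -/
theorem le_two_pow (c C n : ℕ) : C * n ^ c ≤ 2 ^ (n.size * c + C) := by
  rw [pow_add, pow_mul, mul_comm]
  exact Nat.mul_le_mul (Nat.pow_le_pow_left (Nat.lt_size_self n).le c) C.lt_two_pow_self.le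

/-- The number of copies in the reduction is polynomially bounded. -/
theorem two_pow_le (c C : ℕ) {n : ℕ} (hn : 0 < n) :
    2 ^ (n.size * c + C) ≤ 2 ^ C * (2 * n) ^ c := by
  rw [pow_add, pow_mul, mul_comm]
  refine Nat.mul_le_mul_left _ (Nat.pow_le_pow_left ?_ c)
  obtain ⟨m, hm⟩ := Nat.exists_eq_succ_of_ne_zero (Nat.size_pos.2 hn).ne'
  have : 2 ^ m ≤ n := Nat.lt_size.1 (by omega)
  rw [hm, pow_succ]
  omega

theorem length_encodeGraphInt (I : FinGraph × ℤ) : (encodeGraphInt I).length =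
    I.1.order * (I.1.order + 1) + (I.2.natAbs.size + 1) := by
  rw [encodeGraphInt, List.length_append, length_encodeGraph, List.length_map, encodeInt,
    List.length_cons, length_encodeNat]

theorem polyTime_reduction (c C : ℕ) :
    PolyTime encodeGraphInt encodeGraphInt (reduction c C) := by
  refine FP.polyTime ?_
  let sz (I : FinGraph × ℤ) : ℕ := (encodeGraphInt I).length
  have h₀ : FP sz encodeGraphInt encodeGraphInt := FP.refl (PolyLE.self sz)
  let U (I : FinGraph × ℤ) : List Bool := List.replicate (I.1.order.size * c + C) false
  have hU : FP sz encodeGraphInt U :=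
    ((((FP.encodeGraph (x := id) h₀).filter Option.isNone).replicate_size.flatMap
      fun b => List.replicate c b).append (FP.const (PolyLE.self sz)
        (List.replicate C false))).congr (fun _ => rfl) fun I => by
        have h (n : ℕ) : (List.replicate n false).flatMap (List.replicate c ·) =
            List.replicate (n * c) false := by
          induction n with
          | zero => simp
          | succ n ih =>
            rw [List.replicate_succ, List.flatMap_cons, ih, List.replicate_append_replicate,
              Nat.succ_mul, add_comm]
        simp only [U, filter_encodeGraph, h, List.replicate_append_replicate, id]
  have hn : PolyLE sz fun I => I.1.order := (PolyLE.self sz).mono fun I => by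
    simp only [sz, length_encodeGraphInt]
    nlinarith
  have hk : PolyLE sz fun I => I.2.natAbs.size := (PolyLE.self sz).mono fun I => by
    simp only [sz, length_encodeGraphInt]
    omega
  have hM : PolyLE sz fun I => 2 ^ C * (2 * I.1.order) ^ c * I.1.order :=
    ((PolyLE.const _ _).mul (((PolyLE.const _ 2).mul hn).pow c)).mul hn
  have hB : PolyLE sz fun I => 2 ^ C * (2 * I.1.order) ^ c * I.1.order *
      (2 ^ C * (2 * I.1.order) ^ c * I.1.order + 1) + (I.2.natAbs.size + (U I).length + 1) :=
    (hM.mul (hM.add (.const _ 1))).add ((hk.add hU.length_output).add (.const _ 1))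
  have hSt (I : FinGraph × ℤ) (i : ℕ) (hi : i ≤ (U I).length) :
      (encodeGraphInt (double^[i] I)).length ≤ 2 ^ C * (2 * I.1.order) ^ c * I.1.order *
      (2 ^ C * (2 * I.1.order) ^ c * I.1.order + 1) + (I.2.natAbs.size + (U I).length + 1) := by
    have h₁ : 2 ^ i * I.1.order ≤ 2 ^ C * (2 * I.1.order) ^ c * I.1.order := by
      refine Nat.mul_le_mul_right _ (le_trans ?_ (two_pow_le c C I.1.order_pos))
      exact Nat.pow_le_pow_right (by norm_num) (by simpa [U] using hi)
    have h₂ : (2 ^ i * I.2.natAbs).size ≤ I.2.natAbs.size + (U I).length := by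
      refine Nat.size_le.2 ?_
      rw [pow_add, mul_comm]
      exact Nat.mul_lt_mul_of_lt_of_le (Nat.lt_size_self _)
        (Nat.pow_le_pow_right (by norm_num) hi) (by positivity)
    rw [length_encodeGraphInt, iterate_double_order, iterate_double_snd, Int.natAbs_mul,
      Int.natAbs_pow]
    exact add_le_add (Nat.mul_le_mul h₁ (Nat.succ_le_succ h₁)) (Nat.succ_le_succ h₂)
  refine (FP.loop (St := fun I i => encodeGraphInt (double^[i] I)) hU h₀ ?_ hB hSt).congr
    (fun _ => rfl) fun I => ?_
  · have hl : PolyLE (fun x : {x : (FinGraph × ℤ) × ℕ // x.2 < (U x.1).length} => sz x.1.1)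
        fun x => (encodeGraphInt (double^[x.1.2] x.1.1)).length :=
      (hB.comp fun x : {x : (FinGraph × ℤ) × ℕ // x.2 < (U x.1).length} => x.1.1).mono
        fun x => hSt _ _ x.2.le
    exact (FP.refl hl).double.congr (fun _ => rfl) fun x => by rw [iterate_succ_apply']
  · simp [U, reduction]

theorem card_setUnion {G H : FinGraph} (S : Finset G.V) (T : Finset H.V) :
    (setUnion S T).card = S.card + T.card :=
  (Finset.card_map _).trans (Finset.card_disjSum S T)

section

variable {X : (G : FinGraph) → Set (Finset G.V)} {p : (G : FinGraph) → Finset G.V → ℕ}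

/-- A member of `X G` gives a member for `2 ^ i` copies of `G`, with the same value of `p`. -/
theorem exists_mem_iterate_double
    (hXunion : ∀ G₁ G₂ : FinGraph, X (G₁.disjUnion G₂) =
      {S | ∃ S₁ ∈ X G₁, ∃ S₂ ∈ X G₂, S = setUnion S₁ S₂})
    (hpunion : ∀ G₁ G₂ : FinGraph, ∀ S₁ ∈ X G₁, ∀ S₂ ∈ X G₂,
      p (G₁.disjUnion G₂) (setUnion S₁ S₂) = max (p G₁ S₁) (p G₂ S₂))
    (i : ℕ) (I : FinGraph × ℤ) {S : Finset I.1.V} (hS : S ∈ X I.1) :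
    ∃ T ∈ X (double^[i] I).1, T.card = 2 ^ i * S.card ∧ p _ T = p _ S := by
  induction i with
  | zero => exact ⟨S, hS, by simp, rfl⟩
  | succ i ih =>
    obtain ⟨T, hT, hc, hp⟩ := ih
    rw [iterate_succ_apply']
    refine ⟨setUnion T T, ?_, ?_, ?_⟩
    · change _ ∈ X ((double^[i] I).1.disjUnion (double^[i] I).1)
      rw [hXunion]
      exact ⟨T, hT, T, hT, rfl⟩
    · exact (card_setUnion T T).trans (by rw [hc]; ring)
    · exact (hpunion _ _ T hT T hT).trans (by rw [max_self, hp])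

/-- Among the `2 ^ i` sets that form a member of `X` for `2 ^ i` copies of `G`, one has at most the
average size. -/
theorem exists_mem_of_iterate_double
    (hXunion : ∀ G₁ G₂ : FinGraph, X (G₁.disjUnion G₂) =
      {S | ∃ S₁ ∈ X G₁, ∃ S₂ ∈ X G₂, S = setUnion S₁ S₂})
    (i : ℕ) (I : FinGraph × ℤ) :
    ∀ T ∈ X (double^[i] I).1, ∃ S ∈ X I.1, 2 ^ i * S.card ≤ T.card := by
  induction i with
  | zero => exact fun T hT => ⟨T, hT, by simp⟩
  | succ i ih =>
    rw [iterate_succ_apply']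
    change ∀ T ∈ X ((double^[i] I).1.disjUnion (double^[i] I).1), _
    rw [hXunion]
    rintro _ ⟨T₁, hT₁, T₂, hT₂, rfl⟩
    obtain ⟨S₁, hS₁, h₁⟩ := ih T₁ hT₁
    obtain ⟨S₂, hS₂, h₂⟩ := ih T₂ hT₂
    have hc := card_setUnion T₁ T₂
    rcases le_total S₁.card S₂.card with h | h
    · refine ⟨S₁, hS₁, ?_⟩
      have := Nat.mul_le_mul_left (2 ^ i) h
      rw [pow_succ, mul_assoc, mul_left_comm, two_mul]
      exact (add_le_add h₁ (this.trans h₂)).trans_eq hc.symm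
    · refine ⟨S₂, hS₂, ?_⟩
      have := Nat.mul_le_mul_left (2 ^ i) h
      rw [pow_succ, mul_assoc, mul_left_comm, two_mul]
      exact (add_le_add (this.trans h₁) h₂).trans_eq hc.symm

/-- With `2 ^ i` copies of `G`, minimizing `|S|` takes precedence over minimizing `p`: if `|S| < k`,
then `2 ^ i * |S| + p G S < 2 ^ i * k` because `p G S < 2 ^ i`. -/
theorem reduction_mem_XPThrottling
    (hXunion : ∀ G₁ G₂ : FinGraph, X (G₁.disjUnion G₂) =
      {S | ∃ S₁ ∈ X G₁, ∃ S₂ ∈ X G₂, S = setUnion S₁ S₂})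
    (hpunion : ∀ G₁ G₂ : FinGraph, ∀ S₁ ∈ X G₁, ∀ S₂ ∈ X G₂,
      p (G₁.disjUnion G₂) (setUnion S₁ S₂) = max (p G₁ S₁) (p G₂ S₂))
    {c C : ℕ} (hb : ∀ G, ∀ S ∈ X G, p G S < C * G.order ^ c) (I : FinGraph × ℤ) :
    I ∈ MinimumXSet X ↔ reduction c C I ∈ XPThrottling X p := by
  rw [mem_MinimumXSet, mem_XPThrottling, reduction, iterate_double_snd]
  have h2 : (0 : ℤ) < 2 ^ (I.1.order.size * c + C) := by positivity
  constructor
  · rintro ⟨S, hS, hk⟩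
    obtain ⟨T, hT, hc, hp⟩ := exists_mem_iterate_double hXunion hpunion
      (I.1.order.size * c + C) I hS
    refine ⟨T, hT, ?_⟩
    have h : p I.1 S < 2 ^ (I.1.order.size * c + C) := (hb _ S hS).trans_le (le_two_pow c C _)
    rw [hc, hp]
    push_cast
    have h' : (p I.1 S : ℤ) < 2 ^ (I.1.order.size * c + C) := by exact_mod_cast h
    nlinarith
  · rintro ⟨T, hT, hk⟩
    obtain ⟨S, hS, hc⟩ := exists_mem_of_iterate_double hXunion _ I T hT
    refine ⟨S, hS, lt_of_mul_lt_mul_left (lt_of_le_of_lt ?_ hk) h2.le⟩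
    have : ((2 ^ (I.1.order.size * c + C) * S.card : ℕ) : ℤ) ≤ T.card := by exact_mod_cast hc
    push_cast at this ⊢
    omega

end

theorem PolyTime.comp {α β γ Γ Δ Θ : Type} [Finite Γ] [Finite Δ] {ea : α → List Γ}
    {eb : β → List Δ} {ec : γ → List Θ} {f : α → β} {g : β → γ} (hf : PolyTime ea eb f)
    (hg : PolyTime eb ec g) : PolyTime ea ec fun a => g (f a) := by
  have h := hf.fp (sz := fun a => (ea a).length) id (PolyLE.self _)
  exact FP.polyTime (h.trans (hg.fp f h.length_output))

end Throttling

theorem theorem3p2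
    (X : (G : Throttling.FinGraph) → Set (Finset G.V))
    (p : (G : Throttling.FinGraph) → Finset G.V → ℕ)
    -- membership `S ∈ X(G)` can be verified in polynomial time
    (hX : Throttling.InNP Throttling.encodeGraphSet
      {I : (G : Throttling.FinGraph) × Finset G.V | I.2 ∈ X I.1})
    -- `p(G; S) < b(G) = O(|V(G)| ^ c)` for `S ∈ X(G)`, with `b` computable in polynomial time
    (hb : ∃ (b : Throttling.FinGraph → ℕ) (c C : ℕ),
      (∀ G, ∀ S ∈ X G, p G S < b G) ∧ (∀ G, b G ≤ C * G.order ^ c) ∧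
      Throttling.PolyTime Throttling.encodeGraph Computability.encodeNat b)
    -- `p(G; S)` can be computed in polynomial time from `G` and `S ∈ X(G)`
    (hp : Throttling.PolyTime
      (fun I : {I : (G : Throttling.FinGraph) × Finset G.V // I.2 ∈ X I.1} =>
        Throttling.encodeGraphSet I.1)
      Computability.encodeNat (fun I => p I.1.1 I.1.2))
    (hXunion : ∀ G₁ G₂ : Throttling.FinGraph, X (G₁.disjUnion G₂) =
      {S | ∃ S₁ ∈ X G₁, ∃ S₂ ∈ X G₂, S = Throttling.setUnion S₁ S₂})
    (hpunion : ∀ G₁ G₂ : Throttling.FinGraph, ∀ S₁ ∈ X G₁, ∀ S₂ ∈ X G₂,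
      p (G₁.disjUnion G₂) (Throttling.setUnion S₁ S₂) = max (p G₁ S₁) (p G₂ S₂))
    (hNP : Throttling.NPComplete Throttling.encodeGraphInt (Throttling.MinimumXSet X)) :
    Throttling.NPComplete Throttling.encodeGraphInt (Throttling.XPThrottling X p) := by
  refine ⟨Throttling.inNP_XPThrottling hX hp, fun A hA => ?_⟩
  obtain ⟨b, c, C, hpb, hbC, -⟩ := hb
  obtain ⟨f, hf, hfA⟩ := hNP.2 A hA
  exact ⟨fun w => Throttling.reduction c C (f w), hf.comp (Throttling.polyTime_reduction c C),
    fun w => (hfA w).trans (Throttling.reduction_mem_XPThrottling hXunion hpunion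
      (fun G S hS => (hpb G S hS).trans_le (hbC G)) (f w))⟩
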